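/- Let $p$ be a prime, $W=W(\overline{\mathbb F}_p)$ the ring of Witt vectors of $\overline{\mathbb F}_p$, and $K=\mathrm{Frac}\,W$. For $a\in\mathbb Z_p$ the Dwork prime is $a'=(a+l)/p$, where $l\in\{0,\dots,p-1\}$ is the integer with $a+l\equiv0 \bmod p$; put $a^{(0)}=a$ and $a^{(k+1)}=(a^{(k)})'$. Let $s\ge1$, $\underline a=(a_1,\dots,a_s)\in\mathbb Z_p^s$ and $\underline a^{(k)}=(a_1^{(k)},\dots,a_s^{(k)})$, and set $$F_{\underline a}(t)=\sum_{n\ge0}\frac{(a_1)_n}{n!}\cdots\frac{(a_s)_n}{n!}\,t^n\in\mathbb Z_p[[t]],\qquad (a)_n=a(a+1)\cdots(a+n-1).$$ Let $c\in1+pW$, and let $\sigma$ be the endomorphism of $W[[t]]$ with $\sigma(t)=ct^p$ that acts on coefficients by the Witt vector Frobenius. Let $\log$ be the Iwasawa logarithm, $$\gamma_p=-\lim_{m\to\infty}\frac1{p^m}\sum_{0\le j<p^m,\,p\nmid j}\log j,\qquad \psi_p(z)=-\gamma_p+\lim_{n\in\mathbb Z_{>0},\,n\to z}\ \sum_{1\le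 k<n,\,p\nmid k}\frac1k\quad(z\in\mathbb Z_p),$$ and define $$G_{\underline a}(t)=\sum_{i=1}^s\psi_p(a_i)+s\gamma_p-p^{-1}\log c+\int_0^t\bigl(F_{\underline a}(t)-F_{\underline a'}(t)^{\sigma}\bigr)\frac{dt}t\in K[[t]],\qquad \mathcal F^{(\sigma)}_{\underline a}(t)=\frac{G_{\underline a}(t)}{F_{\underline a}(t)},$$ where $\int_0^t(-)\frac{dt}t$ sends $\sum_{n\ge1}f_nt^n$ to $\sum_{n\ge1}\frac{f_n}{n}t^n$. For a power series $f=\sum f_nt^n$ write $f(t)_{<m}=\sum_{n<m}f_nt^n$. Suppose that there is an integer $r\ge0$ with $a_i^{(r+1)}=a_i$ for all $i$. Then $$\mathcal F^{(\sigma)}_{\underline a}(t)\in W\langle t,F_{\underline a}(t)_{<p}^{-1},\dots,F_{\underline a^{(r)}}(t)_{<p}^{-1}\rangle:=\varprojlim_n W/p^n\bigl[t,F_{\underline a}(t)_{<p}^{-1},\dots,F_{\underline a^{(r)}}(t)_{<p}^{-1}\bigr],$$ that is, $\mathcal F^{(\sigma)}_{\underline a}(t)$ is the power series expansion at $t=0$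 of a unique element of this ring. Moreover, for every $\alpha\in W$ such that $F_{\underline a^{(k)}}(\alpha)_{<p}\not\equiv0\bmod p$ for all $0\le k\le r$, the value $\mathcal F^{(\sigma)}_{\underline a}(\alpha)\in W$ of this element at $t=\alpha$ is defined, $F_{\underline a}(\alpha)_{<p^n}\neq0$ for all $n\ge0$, and $p$-adically $$\mathcal F^{(\sigma)}_{\underline a}(\alpha)=\lim_{n\to\infty}\frac{G_{\underline a}(\alpha)_{<p^n}}{F_{\underline a}(\alpha)_{<p^n}}.$$ -/

import Mathlib

open Filter Topology PowerSeries

noncomputable section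

namespace PadicHG

/-! ## The Witt ring `W = W(𝔽̄_p)`, its fraction field `K`, and `p`-adic limits in `K` -/

/-- `W = W(𝔽̄_p)`. -/
abbrev W (p : ℕ) [Fact p.Prime] : Type := WittVector p (AlgebraicClosure (ZMod p))

/-- `K = Frac W`. -/
abbrev K (p : ℕ) [Fact p.Prime] : Type := FractionRing (W p)

/-- The neighbourhood filter of `x` in `K` for the `p`-adic topology: the sets `x + p ^ N W`
form a basis. -/
def padicNhds (p : ℕ) [Fact p.Prime] (x : K p) : Filter (K p) :=
  ⨅ N : ℕ, 𝓟 {y | ∃ w : W p, y - x = (p : K p) ^ N * algebraMap (W p) (K p) w}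

/-- The `p`-adic limit in `K` of `u` along the filter `l` (meaningful when it exists). -/
def padicLim {ι : Type*} (p : ℕ) [Fact p.Prime] (l : Filter ι) (u : ι → K p) : K p :=
  Classical.epsilon fun x => Tendsto u l (padicNhds p x)

/-- The canonical inclusion `ℤ_p = W(𝔽_p) → W(𝔽̄_p)`. -/
def zpToW (p : ℕ) [Fact p.Prime] : ℤ_[p] →+* W p :=
  (WittVector.map (algebraMap (ZMod p) (AlgebraicClosure (ZMod p)))).comp
    (WittVector.fromPadicInt p)

/-! ## Logarithm, Euler constant and digamma function -/

/-- The Iwasawa logarithm on `1 + pW`: `log z = -∑_{n ≥ 1} (1 - z) ^ n / n`. -/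
def logOne (p : ℕ) [Fact p.Prime] (z : K p) : K p :=
  padicLim p atTop fun N : ℕ => -∑ n ∈ Finset.Icc 1 N, (1 - z) ^ n / (n : K p)

/-- The Iwasawa logarithm of an integer `j` prime to `p`. The logarithm being a homomorphism,
`log j = log (j ^ (p - 1)) / (p - 1)`, and `j ^ (p - 1) ∈ 1 + pℤ_p`. -/
def logNat (p : ℕ) [Fact p.Prime] (j : ℕ) : K p :=
  logOne p ((j : K p) ^ (p - 1)) / ((p - 1 : ℕ) : K p)

/-- The `p`-adic Euler constant
`γ_p = - lim_{s → ∞} p ^ (-s) ∑_{0 ≤ j < p ^ s, p ∤ j} log j`. -/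
def eulerGamma (p : ℕ) [Fact p.Prime] : K p :=
  -padicLim p atTop fun s : ℕ =>
    ((p : K p) ^ s)⁻¹ * ∑ j ∈ (Finset.range (p ^ s)).filter (fun j => ¬ p ∣ j), logNat p j

/-- `ψ̃_p(z) = lim_{n ∈ ℤ_{>0}, n → z} ∑_{1 ≤ k < n, p ∤ k} 1 / k`, for `z ∈ ℤ_p`. -/
def psiTilde (p : ℕ) [Fact p.Prime] (z : ℤ_[p]) : K p :=
  padicLim p (comap (fun n : ℕ => (n : ℤ_[p])) (𝓝 z) ⊓ 𝓟 {n : ℕ | 0 < n}) fun n : ℕ =>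
    ∑ k ∈ (Finset.Ico 1 n).filter (fun k => ¬ p ∣ k), (k : K p)⁻¹

/-- The `p`-adic digamma function `ψ_p(z) = -γ_p + ψ̃_p(z)`. -/
def digamma (p : ℕ) [Fact p.Prime] (z : ℤ_[p]) : K p :=
  -eulerGamma p + psiTilde p z

/-! ## Dwork primes -/

/-- `PadicInt.zmodRepr (-a)` is the integer `l ∈ {0, …, p - 1}` with `a + l ≡ 0 mod p`. -/
lemma dvd_add_zmodRepr_neg (p : ℕ) [Fact p.Prime] (a : ℤ_[p]) :
    (p : ℤ_[p]) ∣ a + ((-a).zmodRepr : ℤ_[p]) := by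
  have h := (-a).sub_zmodRepr_mem
  rw [PadicInt.maximalIdeal_eq_span_p, Ideal.mem_span_singleton] at h
  have h2 := (dvd_neg).2 h
  convert h2 using 1
  ring

/-- The Dwork prime `a' = (a + l) / p`, where `l ∈ {0, …, p - 1}` and `a + l ≡ 0 mod p`. -/
def dworkPrime (p : ℕ) [Fact p.Prime] (a : ℤ_[p]) : ℤ_[p] :=
  Classical.choose (dvd_add_zmodRepr_neg p a)

lemma dworkPrime_spec (p : ℕ) [Fact p.Prime] (a : ℤ_[p]) :
    a + ((-a).zmodRepr : ℤ_[p]) = (p : ℤ_[p]) * dworkPrime p a :=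
  Classical.choose_spec (dvd_add_zmodRepr_neg p a)

/-- The tuple `a^(k) = (a_1^(k), …, a_s^(k))` of `k`-th Dwork primes. -/
def dworkIter (p : ℕ) [Fact p.Prime] {s : ℕ} (a : Fin s → ℤ_[p]) (k : ℕ) : Fin s → ℤ_[p] :=
  fun i => (dworkPrime p)^[k] (a i)

/-! ## The power series `F_a`, `G_a` and `ℱ_a^(σ)` -/

/-- `F_a(t) = ∑_n ∏_i ((a_i)_n / n!) t ^ n`, as a power series over `W`. Here
`Ring.multichoose x n = (x)_n / n!` (see `Ring.factorial_nsmul_multichoose_eq_ascPochhammer`). -/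
def F (p : ℕ) [Fact p.Prime] {s : ℕ} (a : Fin s → ℤ_[p]) : PowerSeries (W p) :=
  PowerSeries.mk fun n => zpToW p (∏ i, Ring.multichoose (a i) n)

/-- The `p`-th Frobenius `σ` of `W⟦t⟧` with `σ(t) = c t ^ p`, compatible with the Frobenius `φ`
of `W`: `σ(∑ f_n t ^ n) = ∑ φ(f_n) c ^ n t ^ (p n)`. -/
def sigma (p : ℕ) [Fact p.Prime] (c : W p) (f : PowerSeries (W p)) : PowerSeries (W p) :=
  PowerSeries.mk fun m =>
    if p ∣ m then WittVector.frobenius (PowerSeries.coeff (m / p) f) * c ^ (m / p) else 0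

/-- The operator `∫_0^t (-) dt/t`, sending `∑_{n ≥ 1} f_n t ^ n` to `∑_{n ≥ 1} (f_n / n) t ^ n`. -/
def intDlog (p : ℕ) [Fact p.Prime] (f : PowerSeries (K p)) : PowerSeries (K p) :=
  PowerSeries.mk fun n => if n = 0 then 0 else PowerSeries.coeff n f / (n : K p)

/-- `G_a(t) = ψ_p(a_1) + ⋯ + ψ_p(a_s) + s γ_p - p⁻¹ log c + ∫_0^t (F_a(t) - F_{a'}(t^σ)) dt/t`. -/
def G (p : ℕ) [Fact p.Prime] {s : ℕ} (c : W p) (a : Fin s → ℤ_[p]) : PowerSeries (K p) :=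
  PowerSeries.C ((∑ i, digamma p (a i)) + (s : K p) * eulerGamma p
      - (p : K p)⁻¹ * logOne p (algebraMap (W p) (K p) c))
    + intDlog p (PowerSeries.map (algebraMap (W p) (K p))
        (F p a - sigma p c (F p (dworkIter p a 1))))

/-- The `p`-adic hypergeometric function of logarithmic type `ℱ_a^(σ)(t) = G_a(t) / F_a(t)`,
as a power series over `K` (the constant term of `F_a` is `1`). -/
def logF (p : ℕ) [Fact p.Prime] {s : ℕ} (c : W p) (a : Fin s → ℤ_[p]) : PowerSeries (K p) :=
  G p c a * (PowerSeries.map (algebraMap (W p) (K p)) (F p a))⁻¹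

/-! ## Rings of convergent functions

For a set `T` of polynomials, `W[t, f⁻¹ (f ∈ T)]` is a localization of `W[t]`, and
`W⟨t, f⁻¹ (f ∈ T)⟩ = lim_n (W/p ^ n)[t, f⁻¹ (f ∈ T)]` is its `p`-adic completion. -/

/-- `W[t, f⁻¹ (f ∈ T)]`. -/
abbrev LocRing (p : ℕ) [Fact p.Prime] (T : Set (Polynomial (W p))) : Type :=
  Localization (Submonoid.closure T)

/-- `W⟨t, f⁻¹ (f ∈ T)⟩`, the inverse limit over `n` of `W[t, f⁻¹ (f ∈ T)] / p ^ n`. -/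
abbrev ConvRing (p : ℕ) [Fact p.Prime] (T : Set (Polynomial (W p))) : Type :=
  AdicCompletion (Ideal.span {(p : LocRing p T)}) (LocRing p T)

/-- A ring homomorphism `φ : A → S` maps the ideal `(p) ^ n` into `(p) ^ n`. -/
lemma span_pow_le_comap (p : ℕ) {A S : Type*} [CommRing A] [CommRing S] (φ : A →+* S) (n : ℕ) :
    Ideal.span {(p : A)} ^ n ≤ (Ideal.span {(p : S)} ^ n).comap φ := by
  rw [Ideal.span_singleton_pow, Ideal.span_singleton_pow, Ideal.span_singleton_le_iff_mem,
    Ideal.mem_comap, map_pow, map_natCast]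
  exact Ideal.mem_span_singleton_self _

/-- The maps `lim_k A / p ^ k → A / p ^ n → S / p ^ n` induced by `φ : A → S` are compatible. -/
lemma extendHom_compat (p : ℕ) {A S : Type*} [CommRing A] [CommRing S] (φ : A →+* S) {m n : ℕ}
    (hle : m ≤ n) :
    (Ideal.Quotient.factorPow (Ideal.span {(p : S)}) hle).comp
      ((Ideal.quotientMap (Ideal.span {(p : S)} ^ n) φ (span_pow_le_comap p φ n)).comp
        (AdicCompletion.evalₐ (Ideal.span {(p : A)}) n :
          AdicCompletion (Ideal.span {(p : A)}) A →+* A ⧸ Ideal.span {(p : A)} ^ n)) =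
    (Ideal.quotientMap (Ideal.span {(p : S)} ^ m) φ (span_pow_le_comap p φ m)).comp
      (AdicCompletion.evalₐ (Ideal.span {(p : A)}) m :
        AdicCompletion (Ideal.span {(p : A)}) A →+* A ⧸ Ideal.span {(p : A)} ^ m) := by
  ext x
  obtain ⟨y, rfl⟩ := AdicCompletion.mk_surjective _ _ x
  have h := congrArg (Ideal.quotientMap (Ideal.span {(p : S)} ^ m) φ (span_pow_le_comap p φ m))
    (AdicCompletion.Ideal.mk_eq_mk _ hle y)
  simp only [RingHom.comp_apply, RingHom.coe_coe, AdicCompletion.evalₐ_mk]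
  exact h

/-- The extension to the `p`-adic completion of `A` of a ring homomorphism `φ` from `A` to a
`p`-adically complete ring `S`, i.e. the inverse limit of the maps `A / p ^ n → S / p ^ n`. -/
def extendHom (p : ℕ) {A S : Type*} [CommRing A] [CommRing S]
    [IsAdicComplete (Ideal.span {(p : S)}) S] (φ : A →+* S) :
    AdicCompletion (Ideal.span {(p : A)}) A →+* S :=
  IsAdicComplete.liftRingHom (Ideal.span {(p : S)})
    (fun n => (Ideal.quotientMap (Ideal.span {(p : S)} ^ n) φ (span_pow_le_comap p φ n)).comp
      (AdicCompletion.evalₐ (Ideal.span {(p : A)}) n : _ →+* _))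
    (extendHom_compat p φ)

/-- An element of `R⟦t⟧` lies in `(p) ^ n` iff all its coefficients do. -/
lemma mem_span_pow_iff (p : ℕ) {R : Type*} [CommRing R] (n : ℕ) (f : PowerSeries R) :
    f ∈ Ideal.span {(p : PowerSeries R)} ^ n ↔
      ∀ m, PowerSeries.coeff m f ∈ Ideal.span {(p : R)} ^ n := by
  simp only [Ideal.span_singleton_pow, Ideal.mem_span_singleton]
  have hC : (p : PowerSeries R) ^ n = PowerSeries.C ((p : R) ^ n) := by simp
  constructor
  · rintro ⟨g, rfl⟩ m
    rw [hC, PowerSeries.coeff_C_mul]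
    exact dvd_mul_right _ _
  · intro h
    choose g hg using h
    refine ⟨PowerSeries.mk g, ?_⟩
    ext m
    rw [hC, PowerSeries.coeff_C_mul, PowerSeries.coeff_mk, hg m]

/-- Power series over a `p`-adically complete ring form a `p`-adically complete ring. -/
instance isAdicComplete_powerSeries (p : ℕ) {R : Type*} [CommRing R]
    [IsAdicComplete (Ideal.span {(p : R)}) R] :
    IsAdicComplete (Ideal.span {(p : PowerSeries R)}) (PowerSeries R) where
  haus' f hf := by
    ext m
    refine IsHausdorff.haus (I := Ideal.span {(p : R)}) inferInstance _ fun n => ?_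
    have h := hf n
    rw [SModEq.sub_mem, sub_zero, smul_eq_mul, Ideal.mul_top] at h ⊢
    exact (mem_span_pow_iff p n f).1 h m
  prec' f hf := by
    have h (m : ℕ) : ∃ L : R, ∀ n, PowerSeries.coeff m (f n) ≡ L
        [SMOD (Ideal.span {(p : R)} ^ n • ⊤ : Submodule R R)] := by
      refine IsPrecomplete.prec inferInstance fun {k n} hkn => ?_
      have h := hf hkn
      rw [SModEq.sub_mem, smul_eq_mul, Ideal.mul_top] at h ⊢
      rw [← map_sub]
      exact (mem_span_pow_iff p k _).1 h m
    choose L hL using h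
    refine ⟨PowerSeries.mk L, fun n => ?_⟩
    rw [SModEq.sub_mem, smul_eq_mul, Ideal.mul_top, mem_span_pow_iff]
    intro m
    have h := hL m n
    rw [SModEq.sub_mem, smul_eq_mul, Ideal.mul_top] at h
    rwa [map_sub, PowerSeries.coeff_mk]

lemma isUnit_map_of_mem_closure {A B : Type*} [CommRing A] [CommRing B] (φ : A →+* B)
    {T : Set A} (hT : ∀ f ∈ T, IsUnit (φ f)) (g : Submonoid.closure T) : IsUnit (φ g) := by
  have h : Submonoid.closure T ≤ (IsUnit.submonoid B).comap (φ : A →* B) :=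
    (Submonoid.closure_le).2 hT
  exact h g.2

/-- The Taylor expansion at `t = 0`, a ring homomorphism `W⟨t, f⁻¹ (f ∈ T)⟩ → W⟦t⟧`, defined when
every `f ∈ T` is invertible in `W⟦t⟧`. -/
def expansion (p : ℕ) [Fact p.Prime] (T : Set (Polynomial (W p)))
    (hT : ∀ f ∈ T, IsUnit (Polynomial.coeToPowerSeries.ringHom f)) :
    ConvRing p T →+* PowerSeries (W p) :=
  extendHom p (IsLocalization.lift (M := Submonoid.closure T)
    (isUnit_map_of_mem_closure Polynomial.coeToPowerSeries.ringHom hT))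

/-- The value at `t = α`, a ring homomorphism `W⟨t, f⁻¹ (f ∈ T)⟩ → W`, defined when
`f(α) ∈ Wˣ` for every `f ∈ T`. -/
def valueAt (p : ℕ) [Fact p.Prime] (T : Set (Polynomial (W p))) (α : W p)
    (hα : ∀ f ∈ T, IsUnit (Polynomial.evalRingHom α f)) : ConvRing p T →+* W p :=
  extendHom p (IsLocalization.lift (M := Submonoid.closure T)
    (isUnit_map_of_mem_closure (Polynomial.evalRingHom α) hα))

/-- The set of truncated polynomials `F_{a^(k)}(t)_{<p}`, `0 ≤ k ≤ r`. -/
def truncSet (p : ℕ) [Fact p.Prime] {s : ℕ} (a : Fin s → ℤ_[p]) (r : ℕ) :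
    Set (Polynomial (W p)) :=
  {f | ∃ k ≤ r, f = PowerSeries.trunc p (F p (dworkIter p a k))}

/-- The truncations `F_{a^(k)}(t)_{<p}` have constant term `1`, so are invertible in `W⟦t⟧`. -/
lemma isUnit_truncSet (p : ℕ) [Fact p.Prime] {s : ℕ} (a : Fin s → ℤ_[p]) (r : ℕ) :
    ∀ f ∈ truncSet p a r, IsUnit (Polynomial.coeToPowerSeries.ringHom f) := by
  rintro f ⟨k, -, rfl⟩
  rw [PowerSeries.isUnit_iff_constantCoeff, ← PowerSeries.coeff_zero_eq_constantCoeff_apply]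
  simp [PowerSeries.coeff_trunc, (Fact.out : p.Prime).pos, F]

/-- An element of `W` that is not divisible by `p` is a unit. -/
lemma isUnit_of_not_dvd (p : ℕ) [Fact p.Prime] {x : W p} (hx : ¬ (p : W p) ∣ x) : IsUnit x := by
  refine WittVector.isUnit_of_coeff_zero_ne_zero x fun h => hx ?_
  rw [← Ideal.mem_span_singleton]
  exact (WittVector.mem_span_p_iff_coeff_zero_eq_zero x).2 h

lemma isUnit_eval_truncSet (p : ℕ) [Fact p.Prime] {s : ℕ} {a : Fin s → ℤ_[p]} {r : ℕ} {α : W p}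
    (hα : ∀ k ≤ r, ¬ (p : W p) ∣
      (PowerSeries.trunc p (F p (dworkIter p a k))).eval α) :
    ∀ f ∈ truncSet p a r, IsUnit (Polynomial.evalRingHom α f) := by
  rintro f ⟨k, hk, rfl⟩
  exact isUnit_of_not_dvd p (hα k hk)

end PadicHG
end

/-! # Congruence relations for `p`-adic hypergeometric functions of logarithmic type -/

noncomputable section

namespace PadicHG

/-! ## Dwork congruences for truncated products -/

section Dwork

variable {R : Type*} [CommRing R]

/-! Write `A_n` for the coefficients of `F_a`, `A'_n` for those of `F_{a'}`, and `u(n)` for the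
product of the ratios `{a_i}_n / {1}_n` of Pochhammer symbols without their multiples of `p`. The
key fact is that `G_a` has coefficients `A_n β(n)` with `β(n) ∈ W`, where `p β(n)` modulo `p ^ l`
depends only on `n` modulo `p ^ l` (`exists_coeff_G_eq`). For `p ∤ n` one has `β(n) = 1 / n`. Since
`A_{pm} = A'_m u(pm)`, for `m ≠ 0` one has `β(pm) = (u(pm) - c ^ m) / (pm u(pm))`. This extends
continuously to `m = 0`, because `(u(pm) - 1) / (pm)` and `(c ^ m - 1) / (pm)` do, with values `∑
ψ̃_p(a_i)` and `p⁻¹ log c` (`exists_unitRatio_eq_one_add`, `exists_pow_eq_one_add`). The extension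
matches the constant term of `G_a`.

Dwork's congruences hold for any two series `∑ A_n f(n) t ^ n` with such continuous weights `f`
(`pow_dvd_bracket`). For the weights `1` and `p β` they say that `G_a / F_a` agrees modulo `p ^ N`
with the quotient of the truncations at `p ^ (N + 1)` (`pow_dvd_mul_tr_sub`).

Modulo `p`, the truncation of `F_a` at `p ^ N` is a product of powers of the polynomials
`F_{a^(i)}(t)_{<p}` (`dvd_trunc_F_sub_prod`). By periodicity these are all inverted, so the
truncation is invertible modulo every `p ^ n`. Taylor expansion detects divisibility by `p ^ n` in
the localization (`pow_dvd_of_pow_dvd_locExpansion`), so congruences of power series descend to it.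
They give the Cauchy sequence defining the element, its uniqueness and, after evaluation at `α`, the
limit formula. -/

/-- `f i ≡ f j mod p ^ (l + e)` whenever `i ≡ j mod p ^ l`. -/
def PLip (p e : ℕ) (f : ℕ → R) : Prop :=
  ∀ l i j, i ≡ j [MOD p ^ l] → (p : R) ^ (l + e) ∣ f i - f j

lemma PLip.const (p e : ℕ) (x : R) : PLip p e (fun _ => x) := fun _ _ _ _ => by simp

lemma PLip.mul {p e : ℕ} {f g : ℕ → R} (hf : PLip p e f) (hg : PLip p e g) :
    PLip p e (fun n => f n * g n) := fun l i j h => by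
  have e1 : f i * g i - f j * g j = (f i - f j) * g i + f j * (g i - g j) := by ring
  rw [e1]
  exact dvd_add ((hf l i j h).mul_right _) ((hg l i j h).mul_left _)

lemma PLip.prod {ι : Type*} {p e : ℕ} {s : Finset ι} {f : ι → ℕ → R}
    (hf : ∀ i ∈ s, PLip p e (f i)) : PLip p e (fun n => ∏ i ∈ s, f i n) := by
  classical
  induction s using Finset.induction_on with
  | empty => simpa using PLip.const p e (1 : R)
  | insert a s ha ih =>
    simp only [Finset.prod_insert ha]
    exact (hf a (Finset.mem_insert_self a s)).mul
      (ih fun i hi => hf i (Finset.mem_insert_of_mem hi))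

lemma PLip.map {S : Type*} [CommRing S] {p e : ℕ} {f : ℕ → R} (hf : PLip p e f) (φ : R →+* S) :
    PLip p e (fun n => φ (f n)) := fun l i j h => by
  have := map_dvd φ (hf l i j h)
  simpa using this

lemma PLip.weaken {p e : ℕ} {f : ℕ → R} (hf : PLip p e f) : PLip p 0 f :=
  fun l i j h => (pow_dvd_pow _ (Nat.le_add_right _ _)).trans (hf l i j h)

lemma PLip.add {p e : ℕ} {f g : ℕ → R} (hf : PLip p e f)
    (hg : PLip p e g) : PLip p e (fun n => f n + g n) := fun l i j h => by
  have := dvd_add (hf l i j h) (hg l i j h)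
  rwa [add_sub_add_comm]

lemma PLip.sub {p e : ℕ} {f g : ℕ → R} (hf : PLip p e f)
    (hg : PLip p e g) : PLip p e (fun n => f n - g n) := fun l i j h => by
  have := dvd_sub (hf l i j h) (hg l i j h)
  rwa [sub_sub_sub_comm]

lemma PLip.natCast {p : ℕ} : PLip p 0 (fun n => (n : R)) := fun l i j h => by
  obtain ⟨x, hx⟩ := (Nat.modEq_iff_dvd.1 h.symm)
  have : (i : R) - j = p ^ l * x := by exact_mod_cast congrArg (Int.cast : ℤ → R) hx
  exact ⟨x, this⟩

/-- The inverse of a unit-valued function. -/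
lemma PLip.of_mul_eq_one {p e : ℕ} {f g : ℕ → R} (hf : PLip p e f)
    (h : ∀ n, f n * g n = 1) : PLip p e g := fun l i j hij => by
  have e1 : g i - g j = -(g i * g j) * (f i - f j) := by
    linear_combination g j * h i - g i * h j
  rw [e1]
  exact (hf l i j hij).mul_left _

lemma PLip.comp_add_mul {p : ℕ} {f : ℕ → R} (hf : PLip p 0 f) (r : ℕ) :
    PLip p 1 (fun j => f (r + p * j)) := fun l i j h => by
  refine hf (l + 1) _ _ ?_
  rw [pow_succ']
  exact (Nat.ModEq.mul_left' p h).add_left r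

/-- The case `l = 0` makes `f` constant modulo `p`. Dividing the variation by `p` consumes the extra
power, so the quotient is again an admissible weight for the induction in `pow_dvd_bracket`. -/
lemma PLip.exists_eq_add {p : ℕ} (hp : IsLeftRegular (p : R)) {f : ℕ → R} (hf : PLip p 1 f) :
    ∃ g : ℕ → R, PLip p 0 g ∧ ∀ n, f n = f 0 + p * g n := by
  have h (n : ℕ) : ∃ x, f n = f 0 + p * x := by
    obtain ⟨x, hx⟩ := hf 0 n 0 (by simpa using Nat.modEq_one)
    exact ⟨x, by rw [← sub_eq_iff_eq_add', hx]; simp⟩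
  choose g hg using h
  refine ⟨g, fun l i j hij => ?_, hg⟩
  obtain ⟨x, hx⟩ := hf l i j hij
  refine ⟨x, hp ?_⟩
  simp only at hx ⊢
  rw [hg i, hg j] at hx
  linear_combination hx

/-- The power series `∑ A_n f(n) t ^ n`. -/
def wser (A f : ℕ → R) : R⟦X⟧ := PowerSeries.mk fun n => A n * f n

/-- The truncation of a power series, as a power series. -/
def tr (M : ℕ) (h : R⟦X⟧) : R⟦X⟧ := (trunc M h : Polynomial R)

lemma coeff_tr (M n : ℕ) (h : R⟦X⟧) : coeff n (tr M h) = if n < M then coeff n h else 0 := by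
  simp [tr, coeff_trunc]

/-- The power series `∑ h_{r + p j} t ^ j`. -/
def residuePart (p r : ℕ) (h : R⟦X⟧) : R⟦X⟧ := PowerSeries.mk fun j => coeff (r + p * j) h

lemma eq_sum_residuePart (p : ℕ) (hp : p ≠ 0) (h : R⟦X⟧) :
    h = ∑ r ∈ Finset.range p, X ^ r * expand p hp (residuePart p r h) := by
  ext n
  rw [map_sum, Finset.sum_eq_single (n % p)]
  · rw [coeff_X_pow_mul', if_pos (Nat.mod_le _ _)]
    have h1 : n - n % p = p * (n / p) := by
      have := Nat.mod_add_div n p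
      omega
    rw [h1, coeff_expand_mul, residuePart, coeff_mk, Nat.mod_add_div]
  · intro r hr hne
    rw [coeff_X_pow_mul']
    split_ifs with hle
    · refine coeff_expand_of_not_dvd p hp _ fun hd => hne ?_
      have := (Nat.modEq_iff_dvd' hle).2 hd
      rw [Nat.ModEq, Nat.mod_eq_of_lt (Finset.mem_range.1 hr)] at this
      exact this
    · rfl
  · intro h1
    exact absurd (Finset.mem_range.2 (Nat.mod_lt _ (Nat.pos_of_ne_zero hp))) h1

lemma residuePart_tr {p r : ℕ} (hr : r < p) (M : ℕ) (h : R⟦X⟧) :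
    residuePart p r (tr (p * M) h) = tr M (residuePart p r h) := by
  ext n
  rw [residuePart, coeff_mk, coeff_tr, coeff_tr, residuePart, coeff_mk]
  have : r + p * n < p * M ↔ n < M := by
    constructor
    · intro h1
      by_contra h2
      have := Nat.mul_le_mul_left p (not_lt.1 h2)
      omega
    · intro h1
      have := Nat.mul_le_mul_left p (Nat.succ_le_of_lt h1)
      rw [Nat.mul_succ] at this
      omega
  simp only [this]

/-- `F_f · (F_g)_{<p ^ N} - F_g · (F_f)_{<p ^ N}`, where `F_f = ∑ A_n f(n) t ^ n`. -/
def bracket (p : ℕ) (A : ℕ → R) (N : ℕ) (f g : ℕ → R) : R⟦X⟧ :=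
  wser A f * tr (p ^ N) (wser A g) - wser A g * tr (p ^ N) (wser A f)

lemma wser_add_mul (A g : ℕ → R) (x y : R) :
    wser A (fun n => x + y * g n) = C x * wser A (fun _ => 1) + C y * wser A g := by
  ext n
  simp [wser]
  ring

lemma tr_add (M : ℕ) (f g : R⟦X⟧) : tr M (f + g) = tr M f + tr M g := by
  simp [tr]

lemma tr_C_mul (M : ℕ) (x : R) (f : R⟦X⟧) : tr M (C x * f) = C x * tr M f := by
  simp [tr, trunc_C_mul]

/-- The bracket is bilinear and alternating in the weights, so the term pairing the two constants
vanishes; every remaining term carries `y` or `v`. -/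
lemma bracket_add_mul (p : ℕ) (A : ℕ → R) (N : ℕ) (f g : ℕ → R) (x y u v : R) :
    bracket p A N (fun n => x + y * f n) (fun n => u + v * g n) =
      C (x * v) * bracket p A N (fun _ => 1) g + C (y * u) * bracket p A N f (fun _ => 1)
        + C (y * v) * bracket p A N f g := by
  simp only [bracket, wser_add_mul, tr_add, tr_C_mul, map_mul]
  ring

/-- Splitting exponents into residue classes modulo `p` turns truncation at `p ^ (N + 1)` into
truncation at `p ^ N` on each class, with weights `ρ r j * f (r + p * j)` relative to the next
sequence `A'`. -/
lemma bracket_succ (p : ℕ) (hp : p ≠ 0) (A A' : ℕ → R) (ρ : ℕ → ℕ → R)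
    (hA : ∀ r < p, ∀ j, A (r + p * j) = A' j * ρ r j) (N : ℕ) (f g : ℕ → R) :
    bracket p A (N + 1) f g = ∑ r ∈ Finset.range p, ∑ s ∈ Finset.range p,
      X ^ (r + s) * expand p hp (bracket p A' N (fun j => ρ r j * f (r + p * j))
        (fun j => ρ s j * g (s + p * j))) := by
  have hw (f : ℕ → R) (r : ℕ) (hr : r < p) :
      residuePart p r (wser A f) = wser A' (fun j => ρ r j * f (r + p * j)) := by
    ext n
    simp only [residuePart, wser, coeff_mk, hA r hr]
    ring
  have h1 (f : ℕ → R) : wser A f = ∑ r ∈ Finset.range p,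
      X ^ r * expand p hp (wser A' (fun j => ρ r j * f (r + p * j))) := by
    conv_lhs => rw [eq_sum_residuePart p hp (wser A f)]
    exact Finset.sum_congr rfl fun r hr => by rw [hw f r (Finset.mem_range.1 hr)]
  have h2 (f : ℕ → R) : tr (p ^ (N + 1)) (wser A f) = ∑ r ∈ Finset.range p,
      X ^ r * expand p hp (tr (p ^ N) (wser A' (fun j => ρ r j * f (r + p * j)))) := by
    conv_lhs => rw [eq_sum_residuePart p hp (tr (p ^ (N + 1)) (wser A f)), pow_succ']
    exact Finset.sum_congr rfl fun r hr => by
      rw [residuePart_tr (Finset.mem_range.1 hr), hw f r (Finset.mem_range.1 hr)]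
  rw [bracket, h2 f, h2 g, h1 f, h1 g, Finset.sum_mul_sum, mul_comm (Finset.sum _ _),
    Finset.sum_mul_sum, ← Finset.sum_sub_distrib]
  refine Finset.sum_congr rfl fun r _ => ?_
  rw [← Finset.sum_sub_distrib]
  refine Finset.sum_congr rfl fun s _ => ?_
  simp only [bracket, map_sub, map_mul]
  ring

lemma dvd_expand {p : ℕ} (hp : p ≠ 0) {n : ℕ} {f : R⟦X⟧} (h : (p : R⟦X⟧) ^ n ∣ f) :
    (p : R⟦X⟧) ^ n ∣ expand p hp f := by
  have := map_dvd (expand p hp) h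
  simpa using this

/-- If the sequences `A_k` satisfy `A_k(r + p j) = A_{k+1}(j) ρ_{k,r}(j)` with
`ρ_{k,r}(i) ≡ ρ_{k,r}(j) mod p ^ (l + 1)` for `i ≡ j mod p ^ l`, then for functions `f`, `g` with
`f(i) ≡ f(j)` and `g(i) ≡ g(j) mod p ^ l` for `i ≡ j mod p ^ l`,
`F_f · (F_g)_{<p ^ N} ≡ F_g · (F_f)_{<p ^ N} mod p ^ N`. -/
theorem pow_dvd_bracket (p : ℕ) (hp : p ≠ 0) (hreg : IsLeftRegular (p : R)) (A : ℕ → ℕ → R)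
    (ρ : ℕ → ℕ → ℕ → R) (hA : ∀ k, ∀ r < p, ∀ j, A k (r + p * j) = A (k + 1) j * ρ k r j)
    (hρ : ∀ k, ∀ r < p, PLip p 1 (ρ k r)) (N k : ℕ) (f g : ℕ → R) (hf : PLip p 0 f)
    (hg : PLip p 0 g) : (p : R⟦X⟧) ^ N ∣ bracket p (A k) N f g := by
  induction N generalizing k f g with
  | zero => simp
  | succ N ih =>
    rw [bracket_succ p hp (A k) (A (k + 1)) (ρ k) (hA k)]
    refine Finset.dvd_sum fun r hr => Finset.dvd_sum fun s hs => Dvd.dvd.mul_left ?_ _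
    refine dvd_expand hp ?_
    -- Each new weight is a constant plus `p` times an admissible weight. As the constants cancel in
    -- the bracket, each surviving term gains a factor `p`.
    obtain ⟨f', hf', ef⟩ := ((hρ k r (Finset.mem_range.1 hr)).mul
      (hf.comp_add_mul r)).exists_eq_add hreg
    obtain ⟨g', hg', eg⟩ := ((hρ k s (Finset.mem_range.1 hs)).mul
      (hg.comp_add_mul s)).exists_eq_add hreg
    rw [funext ef, funext eg, bracket_add_mul, pow_succ]
    have h1 := PLip.const p 0 (1 : R)
    simp only [map_mul, map_natCast]
    refine dvd_add (dvd_add ?_ ?_) ?_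
    · rw [mul_comm ((p : R⟦X⟧) ^ N)]
      exact mul_dvd_mul (dvd_mul_left _ _) (ih (k + 1) _ _ h1 hg')
    · rw [mul_comm ((p : R⟦X⟧) ^ N)]
      exact mul_dvd_mul (dvd_mul_right _ _) (ih (k + 1) _ _ hf' h1)
    · rw [mul_comm ((p : R⟦X⟧) ^ N)]
      exact mul_dvd_mul (dvd_mul_right _ _) (ih (k + 1) _ _ hf' hg')

end Dwork

/-! ## Pochhammer symbols with the multiples of `p` removed -/

section UnitProducts

variable (p : ℕ) [Fact p.Prime]

open Classical in
/-- `x` if `x` is a unit, and `1` otherwise. -/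
def unitPart (x : ℤ_[p]) : ℤ_[p] := if (p : ℤ_[p]) ∣ x then 1 else x

open Classical in
/-- `x` if `x` is not a unit, and `1` otherwise. -/
def nonunitPart (x : ℤ_[p]) : ℤ_[p] := if (p : ℤ_[p]) ∣ x then x else 1

lemma unitPart_mul_nonunitPart (x : ℤ_[p]) : unitPart p x * nonunitPart p x = x := by
  unfold unitPart nonunitPart
  split_ifs <;> simp

lemma isUnit_iff_not_p_dvd (x : ℤ_[p]) : IsUnit x ↔ ¬ (p : ℤ_[p]) ∣ x := by
  rw [← not_iff_not, not_not, ← mem_nonunits_iff, ← IsLocalRing.mem_maximalIdeal,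
    PadicInt.maximalIdeal_eq_span_p, Ideal.mem_span_singleton]

lemma isUnit_unitPart (x : ℤ_[p]) : IsUnit (unitPart p x) := by
  unfold unitPart
  split_ifs with h
  · exact isUnit_one
  · exact (isUnit_iff_not_p_dvd p x).2 h

variable {p}

lemma dvd_iff_of_dvd_sub {R : Type*} [CommRing R] {d x y : R} (h : d ∣ x - y) :
    d ∣ x ↔ d ∣ y :=
  (dvd_iff_dvd_of_dvd_sub h)

/-- The condition `l ≠ 0` lets the congruence decide whether `p` divides, so both sides take the
same branch. -/
lemma unitPart_congr {l : ℕ} (hl : l ≠ 0) {x y : ℤ_[p]} (h : (p : ℤ_[p]) ^ l ∣ x - y) :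
    (p : ℤ_[p]) ^ l ∣ unitPart p x - unitPart p y := by
  have h1 := dvd_iff_of_dvd_sub ((dvd_pow_self (p : ℤ_[p]) hl).trans h)
  unfold unitPart
  by_cases hx : (p : ℤ_[p]) ∣ x
  · rw [if_pos hx, if_pos (h1.1 hx), sub_self]
    exact dvd_zero _
  · rwa [if_neg hx, if_neg (mt h1.2 hx)]

lemma prod_congr_dvd {R ι : Type*} [CommRing R] {d : R} (s : Finset ι) {f g : ι → R}
    (h : ∀ i ∈ s, d ∣ f i - g i) : d ∣ ∏ i ∈ s, f i - ∏ i ∈ s, g i := by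
  rw [← Ideal.mem_span_singleton, ← Ideal.Quotient.eq, map_prod, map_prod]
  exact Finset.prod_congr rfl fun i hi =>
    Ideal.Quotient.eq.2 (Ideal.mem_span_singleton.2 (h i hi))

variable (p) in
/-- `{a}_n`, the product of the units among `a, a + 1, …, a + n - 1`. -/
def unitPoch (a : ℤ_[p]) (n : ℕ) : ℤ_[p] := ∏ i ∈ Finset.range n, unitPart p (a + i)

lemma isUnit_unitPoch (a : ℤ_[p]) (n : ℕ) : IsUnit (unitPoch p a n) :=
  IsUnit.prod_iff.2 fun _ _ => isUnit_unitPart p _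

lemma unitPoch_add (a : ℤ_[p]) (m n : ℕ) :
    unitPoch p a (m + n) = unitPoch p a m * unitPoch p (a + m) n := by
  simp [unitPoch, Finset.prod_range_add, add_assoc]

lemma unitPoch_congr {l : ℕ} (hl : l ≠ 0) {a b : ℤ_[p]} (h : (p : ℤ_[p]) ^ l ∣ a - b) (n : ℕ) :
    (p : ℤ_[p]) ^ l ∣ unitPoch p a n - unitPoch p b n :=
  prod_congr_dvd _ fun i _ => unitPart_congr hl (by simpa using h)

lemma exists_nat_congr (a : ℤ_[p]) (l : ℕ) : ∃ N : ℕ, (p : ℤ_[p]) ^ l ∣ (N : ℤ_[p]) - a := by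
  refine ⟨a.appr l, ?_⟩
  have := a.appr_spec l
  rw [Ideal.mem_span_singleton] at this
  exact (dvd_sub_comm).1 this

/-- Shifting the window by one trades the factor of `x` for that of `x + p ^ l`, which is congruent
to it. -/
lemma unitPoch_pow_succ {l : ℕ} (hl : l ≠ 0) (x : ℤ_[p]) :
    (p : ℤ_[p]) ^ l ∣ unitPoch p (x + 1) (p ^ l) - unitPoch p x (p ^ l) := by
  have h1 : unitPoch p x (p ^ l) * unitPart p (x + (p ^ l : ℕ)) =
      unitPart p x * unitPoch p (x + 1) (p ^ l) := by
    simp only [unitPoch]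
    rw [← Finset.prod_range_succ (fun i : ℕ => unitPart p (x + i)), Finset.prod_range_succ']
    rw [mul_comm]
    simp only [Nat.cast_zero, add_zero]
    congr 1
    exact Finset.prod_congr rfl fun i _ => by push_cast; ring_nf
  have h2 : (p : ℤ_[p]) ^ l ∣ unitPart p (x + (p ^ l : ℕ)) - unitPart p x :=
    unitPart_congr hl (by simp)
  rw [← (isUnit_unitPart p x).dvd_mul_left]
  have : unitPart p x * (unitPoch p (x + 1) (p ^ l) - unitPoch p x (p ^ l)) =
      unitPoch p x (p ^ l) * (unitPart p (x + (p ^ l : ℕ)) - unitPart p x) := by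
    rw [mul_sub, ← h1]; ring
  rw [this]
  exact h2.mul_left _

lemma unitPoch_pow_add_nat {l : ℕ} (hl : l ≠ 0) (x : ℤ_[p]) (N : ℕ) :
    (p : ℤ_[p]) ^ l ∣ unitPoch p (x + N) (p ^ l) - unitPoch p x (p ^ l) := by
  induction N with
  | zero => simp
  | succ N ih =>
    have := dvd_add (unitPoch_pow_succ hl (x + (N : ℤ_[p]))) ih
    simpa [add_assoc] using this

/-- The product of the units among `p ^ l` consecutive integers does not depend on them modulo
`p ^ l`. -/
lemma unitPoch_pow_congr {l : ℕ} (hl : l ≠ 0) (x y : ℤ_[p]) :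
    (p : ℤ_[p]) ^ l ∣ unitPoch p x (p ^ l) - unitPoch p y (p ^ l) := by
  obtain ⟨N, hN⟩ := exists_nat_congr (x - y) l
  have h1 := unitPoch_pow_add_nat hl y N
  have h2 : (p : ℤ_[p]) ^ l ∣ x - (y + (N : ℤ_[p])) := by
    rw [dvd_sub_comm]
    convert hN using 1
    ring
  have h3 := unitPoch_congr hl h2 (p ^ l)
  have := dvd_add h3 h1
  simpa using this

variable (p) in
/-- `{a}_n / {1}_n`. -/
def unitRatio (a : ℤ_[p]) (n : ℕ) : ℤ_[p] :=
  unitPoch p a n * ((isUnit_unitPoch (1 : ℤ_[p]) n).unit⁻¹ : (ℤ_[p])ˣ)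

lemma unitRatio_mul (a : ℤ_[p]) (n : ℕ) : unitRatio p a n * unitPoch p 1 n = unitPoch p a n := by
  simp [unitRatio, mul_assoc]

lemma isUnit_unitRatio (a : ℤ_[p]) (n : ℕ) : IsUnit (unitRatio p a n) :=
  (isUnit_unitPoch a n).mul (Units.isUnit _)

lemma unitRatio_zero (a : ℤ_[p]) : unitRatio p a 0 = 1 := by
  have := unitRatio_mul a 0
  simpa [unitPoch] using this

lemma unitRatio_congr {l : ℕ} (hl : l ≠ 0) {a b : ℤ_[p]} (h : (p : ℤ_[p]) ^ l ∣ a - b) (n : ℕ) :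
    (p : ℤ_[p]) ^ l ∣ unitRatio p a n - unitRatio p b n := by
  rw [← (isUnit_unitPoch (1 : ℤ_[p]) n).dvd_mul_right, sub_mul, unitRatio_mul, unitRatio_mul]
  exact unitPoch_congr hl h n

/-- Numerator and denominator each gain a full window of length `p ^ l`; the two window products are
congruent and cancel. -/
lemma unitRatio_add_pow {l : ℕ} (hl : l ≠ 0) (a : ℤ_[p]) (n : ℕ) :
    (p : ℤ_[p]) ^ l ∣ unitRatio p a (n + p ^ l) - unitRatio p a n := by
  rw [← (isUnit_unitPoch (1 : ℤ_[p]) (n + p ^ l)).dvd_mul_right, sub_mul, unitRatio_mul,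
    unitPoch_add, unitPoch_add, ← unitRatio_mul a n]
  have : unitRatio p a n * unitPoch p 1 n * unitPoch p (a + n) (p ^ l) -
      unitRatio p a n * (unitPoch p 1 n * unitPoch p (1 + n) (p ^ l)) =
      unitRatio p a n * unitPoch p 1 n *
        (unitPoch p (a + n) (p ^ l) - unitPoch p (1 + n) (p ^ l)) := by ring
  rw [this]
  exact (unitPoch_pow_congr hl _ _).mul_left _

lemma unitRatio_add_pow_mul {l : ℕ} (hl : l ≠ 0) (a : ℤ_[p]) (n j : ℕ) :
    (p : ℤ_[p]) ^ l ∣ unitRatio p a (n + p ^ l * j) - unitRatio p a n := by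
  induction j with
  | zero => simp
  | succ j ih =>
    have := dvd_add (unitRatio_add_pow hl a (n + p ^ l * j)) ih
    simpa [mul_add, add_assoc] using this

lemma unitRatio_pLip (a : ℤ_[p]) : PLip p 0 (unitRatio p a) := by
  intro l i j h
  rw [add_zero]
  rcases eq_or_ne l 0 with rfl | hl
  · simp
  wlog hij : i ≤ j generalizing i j
  · rw [dvd_sub_comm]
    exact this j i h.symm (le_of_not_ge hij)
  obtain ⟨k, hk⟩ := (Nat.modEq_iff_dvd' hij).1 h
  obtain rfl : j = i + p ^ l * k := by omega
  rw [dvd_sub_comm]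
  exact unitRatio_add_pow_mul hl a i k

/-! ## The coefficients `(a)_n / n!` -/

lemma factorial_mul_multichoose (a : ℤ_[p]) (n : ℕ) :
    (n.factorial : ℤ_[p]) * Ring.multichoose a n = ∏ i ∈ Finset.range n, (a + i) := by
  have := Ring.factorial_nsmul_multichoose_eq_ascPochhammer a n
  rw [nsmul_eq_mul] at this
  rw [this, Polynomial.ascPochhammer_smeval_eq_eval]
  induction n with
  | zero => simp
  | succ n ih =>
    rw [ascPochhammer_succ_eval, Finset.prod_range_succ, ih]
    exact Ring.factorial_nsmul_multichoose_eq_ascPochhammer a n |>.symm ▸ (nsmul_eq_mul _ _).symm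

variable (p) in
/-- `p (a' + j)` if it is among `a + p j, …, a + p j + r - 1`, and `1` otherwise. -/
def pFactor (a : ℤ_[p]) (r j : ℕ) : ℤ_[p] :=
  if (-a).zmodRepr < r then p * (dworkPrime p a + j) else 1

lemma p_dvd_natCast (n : ℕ) : (p : ℤ_[p]) ∣ n ↔ p ∣ n := by
  have := PadicInt.norm_int_lt_one_iff_dvd (p := p) n
  rw [← PadicInt.norm_lt_one_iff_dvd]
  exact_mod_cast this

lemma p_dvd_add_iff (a : ℤ_[p]) (i : ℕ) (hi : i < p) :
    (p : ℤ_[p]) ∣ a + i ↔ i = (-a).zmodRepr := by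
  have h0 := dvd_add_zmodRepr_neg p a
  constructor
  · intro h
    have h1 := dvd_sub h h0
    rw [add_sub_add_left_eq_sub] at h1
    have h2 : (i : ZMod p) = ((-a).zmodRepr : ZMod p) := by
      have := map_dvd (PadicInt.toZMod (p := p)) h1
      simpa [sub_eq_zero] using this
    rw [ZMod.natCast_eq_natCast_iff] at h2
    exact Nat.ModEq.eq_of_lt_of_lt h2 hi (-a).zmodRepr_lt_p
  · rintro rfl
    exact h0

lemma dworkPrime_eq {a b : ℤ_[p]} {l : ℕ} (hl : l < p) (h : a + l = p * b) :
    (-a).zmodRepr = l ∧ dworkPrime p a = b := by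
  have h1 : l = (-a).zmodRepr := (p_dvd_add_iff a l hl).1 ⟨b, h⟩
  refine ⟨h1.symm, ?_⟩
  have h2 := dworkPrime_spec p a
  rw [← h1, h] at h2
  exact (mul_left_cancel₀ (by exact_mod_cast (Fact.out : p.Prime).ne_zero) h2).symm

/-- At most one term of the window is divisible by `p`: the one with `i = (-a).zmodRepr`, where the
term equals `p (a' + j)`. -/
lemma prod_nonunitPart_of_le (a : ℤ_[p]) (j r : ℕ) (hr : r ≤ p) :
    ∏ i ∈ Finset.range r, nonunitPart p (a + p * j + i) = pFactor p a r j := by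
  induction r with
  | zero => simp [pFactor]
  | succ r ih =>
    rw [Finset.prod_range_succ, ih (by omega)]
    have h1 : (p : ℤ_[p]) ∣ a + p * j + r ↔ r = (-a).zmodRepr := by
      rw [← p_dvd_add_iff a r (by omega)]
      refine dvd_iff_of_dvd_sub ⟨j, by ring⟩
    unfold nonunitPart pFactor
    simp only [h1]
    rcases lt_trichotomy r (-a).zmodRepr with h | h | h
    · simp [h.ne, not_lt.2 h.le, not_lt.2 (Nat.succ_le_of_lt h)]
    · have := dworkPrime_spec p a
      rw [← h] at this ⊢
      simp only [lt_irrefl, if_false, if_true, lt_add_one, one_mul]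
      linear_combination this
    · simp [h.ne', h, h.trans (Nat.lt_succ_self r)]

lemma prod_nonunitPart (a : ℤ_[p]) (j r : ℕ) (hr : r ≤ p) :
    ∏ i ∈ Finset.range (r + p * j), nonunitPart p (a + i) =
      p ^ j * (∏ i ∈ Finset.range j, (dworkPrime p a + i)) * pFactor p a r j := by
  have h1 : ∏ i ∈ Finset.range (p * j), nonunitPart p (a + i) =
      p ^ j * (∏ i ∈ Finset.range j, (dworkPrime p a + i)) := by
    induction j with
    | zero => simp
    | succ j ih =>
      rw [mul_add, mul_one, Finset.prod_range_add, ih, Finset.prod_range_succ]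
      have := prod_nonunitPart_of_le a j p le_rfl
      simp only [Nat.cast_add, Nat.cast_mul, ← add_assoc]
      rw [this, pFactor, if_pos (-a).zmodRepr_lt_p]
      ring
  rw [add_comm r, Finset.prod_range_add, h1, ← prod_nonunitPart_of_le a j r hr]
  simp [add_assoc]

lemma prod_range_add_eq (a : ℤ_[p]) (j r : ℕ) (hr : r ≤ p) :
    ∏ i ∈ Finset.range (r + p * j), (a + i) = unitPoch p a (r + p * j) *
      (p ^ j * (∏ i ∈ Finset.range j, (dworkPrime p a + i)) * pFactor p a r j) := by
  rw [← prod_nonunitPart a j r hr, unitPoch, ← Finset.prod_mul_distrib]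
  simp only [unitPart_mul_nonunitPart]

/-- `A_a(r + p j) = A_{a'}(j) · u_a(r + p j) · (p (a' + j) or 1)`. -/
lemma multichoose_add_mul (a : ℤ_[p]) (j r : ℕ) (hr : r < p) :
    Ring.multichoose a (r + p * j) = Ring.multichoose (dworkPrime p a) j *
      (unitRatio p a (r + p * j) * pFactor p a r j) := by
  have hp : (p : ℤ_[p]) ≠ 0 := by exact_mod_cast (Fact.out : p.Prime).ne_zero
  have h1 := factorial_mul_multichoose a (r + p * j)
  have h2 := factorial_mul_multichoose (1 : ℤ_[p]) (r + p * j)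
  have h3 := factorial_mul_multichoose (1 : ℤ_[p]) j
  have h4 := factorial_mul_multichoose (dworkPrime p a) j
  rw [prod_range_add_eq _ _ _ hr.le] at h1 h2
  -- The denominator `n!` is `(1)_n`, and `1` is its own Dwork prime with `l = p - 1`. As `r < p`,
  -- it contributes no extra factor, and its `p ^ j` cancels the one in the numerator.
  obtain ⟨hl, hd⟩ := dworkPrime_eq (p := p) (a := 1) (b := 1) (l := p - 1)
    (Nat.sub_lt (Fact.out : p.Prime).pos one_pos)
    (by rw [Nat.cast_sub (Fact.out : p.Prime).one_le]; simp)
  rw [Ring.multichoose_one, mul_one] at h2 h3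
  rw [hd, ← h3, pFactor, if_neg (by omega), mul_one] at h2
  rw [← h4, h2, ← unitRatio_mul a] at h1
  have h5 : unitPoch p 1 (r + p * j) * (p ^ j * (j.factorial : ℤ_[p])) ≠ 0 :=
    mul_ne_zero (isUnit_unitPoch _ _).ne_zero
      (mul_ne_zero (pow_ne_zero _ hp) (by exact_mod_cast j.factorial_ne_zero))
  refine mul_left_cancel₀ h5 ?_
  rw [h1]
  ring

/-- The explicit factor `p` in the nonconstant case supplies the additional power. -/
lemma pFactor_pLip (a : ℤ_[p]) (r : ℕ) : PLip p 1 (pFactor p a r) := by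
  intro l i j h
  unfold pFactor
  split_ifs
  · obtain ⟨x, hx⟩ := (Nat.modEq_iff_dvd.1 h.symm)
    have : (i : ℤ_[p]) - j = p ^ l * x := by exact_mod_cast congrArg (Int.cast : ℤ → ℤ_[p]) hx
    exact ⟨x, by linear_combination (p : ℤ_[p]) * this⟩
  · simp

end UnitProducts

/-! ## The ratio `{a}_k / {1}_k` near `k = 0` -/

section Digamma

lemma exists_limit_of_isAdicComplete {R : Type*} [CommRing R] (q : R)
    [IsAdicComplete (Ideal.span {q}) R] (x : ℕ → R) (hx : ∀ n, q ^ n ∣ x n - x (n + 1)) :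
    ∃ L, ∀ n, q ^ n ∣ x n - L := by
  have h1 : ∀ {m n : ℕ}, m ≤ n → q ^ m ∣ x m - x n := by
    intro m n hmn
    induction n, hmn using Nat.le_induction with
    | base => simp
    | succ n hmn ih =>
      have := dvd_add ih ((pow_dvd_pow q hmn).trans (hx n))
      simpa using this
  obtain ⟨L, hL⟩ := IsPrecomplete.prec (I := Ideal.span {q}) (M := R) inferInstance
    (f := x) fun {m n} hmn => by
      rw [SModEq.sub_mem, smul_eq_mul, Ideal.mul_top, Ideal.span_singleton_pow,
        Ideal.mem_span_singleton]
      exact h1 hmn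
  refine ⟨L, fun n => ?_⟩
  have := hL n
  rwa [SModEq.sub_mem, smul_eq_mul, Ideal.mul_top, Ideal.span_singleton_pow,
    Ideal.mem_span_singleton] at this

lemma exists_prod_one_add_X_mul {R ι : Type*} [CommRing R] (s : Finset ι) (c : ι → R) :
    ∃ V : Polynomial R, ∏ i ∈ s, (1 + Polynomial.C (c i) * Polynomial.X) = 1 + Polynomial.X * V ∧
      V.eval 0 = ∑ i ∈ s, c i := by
  classical
  induction s using Finset.induction_on with
  | empty => exact ⟨0, by simp⟩
  | insert a s ha ih =>
    obtain ⟨V, h1, h2⟩ := ih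
    refine ⟨V + Polynomial.C (c a) * (1 + Polynomial.X * V), ?_, ?_⟩
    · rw [Finset.prod_insert ha, h1]
      ring
    · rw [Finset.sum_insert ha, ← h2]
      simp [add_comm]

variable {p : ℕ} [Fact p.Prime]

instance : IsAdicComplete (Ideal.span {(p : ℤ_[p])}) ℤ_[p] := by
  rw [← PadicInt.maximalIdeal_eq_span_p]
  infer_instance

variable (p) in
/-- `∑_{1 ≤ k < N, p ∤ k} 1 / k`. -/
def harmonicUnit (N : ℕ) : ℤ_[p] :=
  ∑ k ∈ (Finset.Ico 1 N).filter (fun k => ¬ p ∣ k), Ring.inverse (k : ℤ_[p])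

lemma isUnit_natCast_of_not_dvd {k : ℕ} (hk : ¬ p ∣ k) : IsUnit (k : ℤ_[p]) := by
  rwa [isUnit_iff_not_p_dvd, p_dvd_natCast]

lemma unitPart_natCast_add (k i : ℕ) (hk : p ∣ k) :
    unitPart p ((k : ℤ_[p]) + i) = unitPart p (0 + i) *
      (if ¬ p ∣ i then 1 + Ring.inverse (i : ℤ_[p]) * k else 1) := by
  have h1 : (p : ℤ_[p]) ∣ (k : ℤ_[p]) + i ↔ p ∣ i := by
    rw [← Nat.cast_add, p_dvd_natCast, Nat.dvd_add_right hk]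
  have h2 : (p : ℤ_[p]) ∣ 0 + (i : ℤ_[p]) ↔ p ∣ i := by
    rw [zero_add, p_dvd_natCast]
  unfold unitPart
  by_cases h : p ∣ i
  · rw [if_pos (h1.2 h), if_pos (h2.2 h), if_neg (by simpa using h), mul_one]
  · rw [if_neg (mt h1.1 h), if_neg (mt h2.1 h), if_pos h, zero_add, mul_add, mul_one, ← mul_assoc,
      Ring.mul_inverse_cancel _ (isUnit_natCast_of_not_dvd h)]
    ring

/-- The two windows differ by exchanging `0` for `k`; both are multiples of `p` and count as `1`. -/
lemma unitPoch_one_eq_zero {k : ℕ} (hk : p ∣ k) : unitPoch p 1 k = unitPoch p 0 k := by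
  have h1 := unitPoch_add (0 : ℤ_[p]) k 1
  rw [add_comm k 1, unitPoch_add (0 : ℤ_[p]) 1 k] at h1
  have h2 : (p : ℤ_[p]) ∣ k := (p_dvd_natCast k).2 hk
  rw [Nat.cast_one, zero_add (1 : ℤ_[p])] at h1
  simpa [unitPoch, unitPart, h2] using h1

/-- For `p ∣ k`, the ratio `{N}_k / {1}_k` is a polynomial in `k`. -/
lemma unitRatio_natCast (N k : ℕ) (hk : p ∣ k) :
    unitRatio p N k = ∏ i ∈ (Finset.Ico 1 N).filter (fun k => ¬ p ∣ k),
      (1 + Ring.inverse (i : ℤ_[p]) * k) := by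
  have h1 : unitPoch p (k : ℤ_[p]) N = unitPoch p 0 N *
      ∏ i ∈ (Finset.Ico 1 N).filter (fun k => ¬ p ∣ k), (1 + Ring.inverse (i : ℤ_[p]) * k) := by
    have h0 : (Finset.Ico 1 N).filter (fun k => ¬ p ∣ k) =
        (Finset.range N).filter (fun k => ¬ p ∣ k) := by
      ext i
      simp only [Finset.mem_filter, Finset.mem_Ico, Finset.mem_range, and_congr_left_iff,
        and_iff_right_iff_imp]
      intro hi _
      exact Nat.one_le_iff_ne_zero.2 fun h => hi (h ▸ dvd_zero p)
    rw [h0, Finset.prod_filter, unitPoch, unitPoch, ← Finset.prod_mul_distrib]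
    exact Finset.prod_congr rfl fun i _ => unitPart_natCast_add k i hk
  -- Splitting `{0}_{N+k}` in two ways gives `{0}_N {N}_k = {0}_k {k}_N`, which exchanges the roles
  -- of `N` and `k`.
  have h2 := unitPoch_add (0 : ℤ_[p]) N k
  rw [add_comm N k, unitPoch_add (0 : ℤ_[p]) k N, zero_add, zero_add, h1,
    ← unitPoch_one_eq_zero hk, ← unitRatio_mul (N : ℤ_[p]) k] at h2
  refine mul_left_cancel₀ (mul_ne_zero (isUnit_unitPoch (0 : ℤ_[p]) N).ne_zero
    (isUnit_unitPoch (1 : ℤ_[p]) k).ne_zero) ?_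
  linear_combination -h2

variable (p) in
lemma exists_unitRatio_polynomial (N : ℕ) : ∃ V : Polynomial ℤ_[p],
    (∀ k, p ∣ k → unitRatio p N k = 1 + k * V.eval (k : ℤ_[p])) ∧
      V.eval 0 = harmonicUnit p N := by
  obtain ⟨V, h1, h2⟩ := exists_prod_one_add_X_mul
    ((Finset.Ico 1 N).filter (fun k => ¬ p ∣ k)) (fun i => Ring.inverse (i : ℤ_[p]))
  refine ⟨V, fun k hk => ?_, h2⟩
  have := congrArg (Polynomial.eval (k : ℤ_[p])) h1
  rw [unitRatio_natCast N k hk]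
  simpa [Polynomial.eval_prod] using this

lemma exists_dvd_pow {k : ℕ} (hk : k ≠ 0) : ∃ v, (k : ℤ_[p]) ∣ (p : ℤ_[p]) ^ v := by
  obtain ⟨v, m, hm, rfl⟩ := Nat.exists_eq_pow_mul_and_not_dvd hk p (Fact.out : p.Prime).ne_one
  refine ⟨v, ?_⟩
  push_cast
  rw [(isUnit_natCast_of_not_dvd hm).mul_right_dvd]

/-- For `p ∣ k`, `{a}_k / {1}_k = 1 + k P(k)` for a function `P` with `P(k) ≡ P(k') mod p ^ l`
if `k ≡ k' mod p ^ l`, and `P(0)` is the limit of the harmonic sums. -/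
theorem exists_unitRatio_eq_one_add (a : ℤ_[p]) : ∃ P : ℕ → ℤ_[p], PLip p 1 P ∧
    (∀ m, unitRatio p a (p * m) = 1 + (p * m : ℕ) * P m) ∧
    ∀ n, ∃ M, ∀ N : ℕ, (p : ℤ_[p]) ^ M ∣ (N : ℤ_[p]) - a →
      (p : ℤ_[p]) ^ n ∣ harmonicUnit p N - P 0 := by
  -- For natural numbers `N` near `a`, the ratio is `1 + k V_N(k)` with `V_N(0)` the harmonic sum.
  -- The function `P` is obtained as the limit of `V_N(p m)` as `N` tends to `a`.
  choose V hV hV0 using exists_unitRatio_polynomial p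
  have hpoly (N i j l : ℕ) (h : i ≡ j [MOD p ^ l]) :
      (p : ℤ_[p]) ^ (l + 1) ∣
        (V N).eval ((p * i : ℕ) : ℤ_[p]) - (V N).eval ((p * j : ℕ) : ℤ_[p]) := by
    refine dvd_trans ?_ (Polynomial.sub_dvd_eval_sub _ _ (V N))
    obtain ⟨x, hx⟩ := (Nat.modEq_iff_dvd.1 h.symm)
    have : (i : ℤ_[p]) - j = p ^ l * x := by exact_mod_cast congrArg (Int.cast : ℤ → ℤ_[p]) hx
    refine ⟨x, ?_⟩
    push_cast
    linear_combination (p : ℤ_[p]) * this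
  have hpos (m : ℕ) (hm : m ≠ 0) : ∃ P : ℤ_[p], unitRatio p a (p * m) = 1 + (p * m : ℕ) * P ∧
      ∀ n, ∃ M, ∀ N : ℕ, (p : ℤ_[p]) ^ M ∣ (N : ℤ_[p]) - a →
        (p : ℤ_[p]) ^ n ∣ (V N).eval ((p * m : ℕ) : ℤ_[p]) - P := by
    have hk : p * m ≠ 0 := mul_ne_zero (Fact.out : p.Prime).ne_zero hm
    obtain ⟨v, d, hd⟩ := exists_dvd_pow (p := p) hk
    -- Recovering `P` requires division by `p m`, which divides `p ^ v`; this costs `v` powers of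
    -- precision. The further `1` keeps the exponent nonzero for `unitRatio_congr`.
    have key (n N : ℕ) (hN : (p : ℤ_[p]) ^ (n + v + 1) ∣ (N : ℤ_[p]) - a) :
        (p : ℤ_[p]) ^ n * (p * m : ℕ) ∣
          1 + (p * m : ℕ) * (V N).eval ((p * m : ℕ) : ℤ_[p]) - unitRatio p a (p * m) := by
      rw [← hV N _ (dvd_mul_right p m)]
      refine dvd_trans ?_ (unitRatio_congr (Nat.succ_ne_zero _) hN _)
      exact ⟨d * p, by rw [pow_succ, pow_add, hd]; ring⟩
    obtain ⟨N, hN⟩ := exists_nat_congr a (0 + v + 1)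
    obtain ⟨x, hx⟩ := key 0 N hN
    have hP : unitRatio p a (p * m) = 1 + (p * m : ℕ) *
        ((V N).eval ((p * m : ℕ) : ℤ_[p]) - x) := by linear_combination -hx
    refine ⟨_, hP, fun n => ⟨n + v + 1, fun N' hN' => ?_⟩⟩
    obtain ⟨y, hy⟩ := key n N' hN'
    refine ⟨y, ?_⟩
    have hk0 : ((p * m : ℕ) : ℤ_[p]) ≠ 0 := by exact_mod_cast hk
    refine mul_left_cancel₀ hk0 ?_
    rw [hP] at hy
    linear_combination hy
  choose! Q hQ hQ' using hpos
  have hpn (n : ℕ) : p ^ n ≠ 0 := pow_ne_zero _ (Fact.out : p.Prime).ne_zero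
  -- At `m = 0` the ratio formula carries no information, so the value there is defined as the limit
  -- along `m = p ^ n`.
  obtain ⟨L, hL⟩ := exists_limit_of_isAdicComplete (p : ℤ_[p]) (fun n => Q (p ^ n)) (by
    intro n
    obtain ⟨M1, h1⟩ := hQ' (p ^ n) (hpn n) n
    obtain ⟨M2, h2⟩ := hQ' (p ^ (n + 1)) (hpn _) n
    obtain ⟨N, hN⟩ := exists_nat_congr a (M1 + M2)
    have h1 := h1 N ((pow_dvd_pow _ (Nat.le_add_right _ _)).trans hN)
    have h2 := h2 N ((pow_dvd_pow _ (Nat.le_add_left _ _)).trans hN)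
    have h3 := hpoly N (p ^ n) (p ^ (n + 1)) n (by
      rw [pow_succ, Nat.modEq_iff_dvd]
      exact ⟨p - 1, by push_cast; ring⟩)
    have := dvd_sub (dvd_add h2 ((pow_dvd_pow _ (Nat.le_succ n)).trans h3)) h1
    convert this using 1
    ring)
  have hall (m : ℕ) : ∀ n, ∃ M, ∀ N : ℕ, (p : ℤ_[p]) ^ M ∣ (N : ℤ_[p]) - a →
      (p : ℤ_[p]) ^ n ∣ (V N).eval ((p * m : ℕ) : ℤ_[p]) - (if m = 0 then L else Q m) := by
    intro n
    split_ifs with hm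
    · subst hm
      obtain ⟨M, hM⟩ := hQ' (p ^ n) (hpn n) n
      refine ⟨M, fun N hN => ?_⟩
      have h3 := hpoly N 0 (p ^ n) n (by simp [Nat.ModEq])
      have := dvd_add (dvd_add ((pow_dvd_pow _ (Nat.le_succ n)).trans h3) (hM N hN)) (hL n)
      convert this using 1
      ring
    · exact hQ' m hm n
  refine ⟨fun m => if m = 0 then L else Q m, fun l i j h => ?_, fun m => ?_, fun n => ?_⟩
  · obtain ⟨M1, h1⟩ := hall i (l + 1)
    obtain ⟨M2, h2⟩ := hall j (l + 1)
    obtain ⟨N, hN⟩ := exists_nat_congr a (M1 + M2)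
    have h1 := h1 N ((pow_dvd_pow _ (Nat.le_add_right _ _)).trans hN)
    have h2 := h2 N ((pow_dvd_pow _ (Nat.le_add_left _ _)).trans hN)
    have := dvd_sub (dvd_add h2 (hpoly N i j l h)) h1
    convert this using 1
    ring
  · by_cases hm : m = 0
    · subst hm
      simp [unitRatio_zero]
    · simpa only [if_neg hm] using hQ m hm
  · obtain ⟨M, hM⟩ := hall 0 n
    refine ⟨M, fun N hN => ?_⟩
    have := hM N hN
    simpa [hV0] using this

end Digamma

/-! ## Limits in `K` -/

section Limits

variable {p : ℕ} [Fact p.Prime]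

lemma p_ne_zero_W : (p : W p) ≠ 0 := WittVector.p_nonzero p _

lemma natCast_ne_zero_W {n : ℕ} (hn : n ≠ 0) : (n : W p) ≠ 0 := by
  obtain ⟨v, hv⟩ := exists_dvd_pow (p := p) hn
  have := map_dvd (zpToW p) hv
  rw [map_natCast, map_pow, map_natCast] at this
  intro h
  rw [h, zero_dvd_iff] at this
  exact pow_ne_zero _ p_ne_zero_W this

lemma natCast_ne_zero_K {n : ℕ} (hn : n ≠ 0) : (n : K p) ≠ 0 := by
  have := (IsFractionRing.injective (W p) (K p)).ne (natCast_ne_zero_W hn)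
  simpa using this

lemma tendsto_padicNhds_iff {ι : Type*} {l : Filter ι} {u : ι → K p} {x : K p} :
    Tendsto u l (padicNhds p x) ↔
      ∀ N : ℕ, ∀ᶠ i in l, ∃ w : W p, u i - x = (p : K p) ^ N * algebraMap (W p) (K p) w := by
  simp only [padicNhds, tendsto_iInf, tendsto_principal, Set.mem_ofPred_eq]

lemma eq_zero_of_forall_pow_dvd {x : W p} (h : ∀ n : ℕ, (p : W p) ^ n ∣ x) : x = 0 := by
  refine IsHausdorff.haus (I := Ideal.span {(p : W p)}) inferInstance _ fun n => ?_
  rw [SModEq.sub_mem, sub_zero, smul_eq_mul, Ideal.mul_top, Ideal.span_singleton_pow,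
    Ideal.mem_span_singleton]
  exact h n

lemma eq_of_forall_sub_eq {x y : K p}
    (h : ∀ N : ℕ, ∃ w : W p, y - x = (p : K p) ^ N * algebraMap (W p) (K p) w) : y = x := by
  obtain ⟨w, hw⟩ := h 0
  rw [pow_zero, one_mul] at hw
  have h0 : w = 0 := by
    refine eq_zero_of_forall_pow_dvd fun n => ?_
    obtain ⟨v, hv⟩ := h n
    refine ⟨v, IsFractionRing.injective (W p) (K p) ?_⟩
    rw [← hw, hv]
    simp
  rw [h0, map_zero, sub_eq_zero] at hw
  exact hw

/-- The choice operator in `padicLim` selects some limit as soon as one exists, and separatedness of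
`K` makes it unique. -/
lemma padicLim_eq {ι : Type*} {l : Filter ι} [l.NeBot] {u : ι → K p} {x : K p}
    (h : ∀ N : ℕ, ∀ᶠ i in l, ∃ w : W p, u i - x = (p : K p) ^ N * algebraMap (W p) (K p) w) :
    padicLim p l u = x := by
  have h1 : Tendsto u l (padicNhds p x) := tendsto_padicNhds_iff.2 h
  have h2 : Tendsto u l (padicNhds p (padicLim p l u)) :=
    Classical.epsilon_spec (p := fun x => Tendsto u l (padicNhds p x)) ⟨x, h1⟩
  rw [tendsto_padicNhds_iff] at h2
  refine eq_of_forall_sub_eq fun N => ?_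
  obtain ⟨i, ⟨v, hv⟩, ⟨w, hw⟩⟩ := ((h N).and (h2 N)).exists
  exact ⟨v - w, by rw [map_sub]; linear_combination hv - hw⟩

/-! ## The function `(c ^ m - 1) / (p m)` -/

variable (p) in
-- The valuation of `(j + 1)!` is at most `j`, so `p ^ j / (j + 1)!` is integral.
lemma exists_mul_factorial_eq (j : ℕ) : ∃ e : W p, e * ((j + 1).factorial : W p) = p ^ j := by
  obtain ⟨v, m, hm, hv⟩ := Nat.exists_eq_pow_mul_and_not_dvd (Nat.factorial_ne_zero (j + 1)) p
    (Fact.out : p.Prime).ne_one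
  have hle : v ≤ j := by
    have h1 : padicValNat p (j + 1).factorial = v := by
      rw [hv, padicValNat.mul (pow_ne_zero _ (Fact.out : p.Prime).ne_zero)
        (by rintro rfl; exact hm (dvd_zero p)), padicValNat.prime_pow,
        padicValNat.eq_zero_of_not_dvd hm,
        add_zero]
    have h2 : padicValNat p (j + 1).factorial < j + 1 :=
      padicValNat_factorial_lt_of_ne_zero (p := p) (Nat.succ_ne_zero j)
    omega
  obtain ⟨u, hu⟩ := (isUnit_natCast_of_not_dvd (p := p) hm).exists_left_inv
  have hu' : zpToW p u * (m : W p) = 1 := by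
    rw [← map_natCast (zpToW p), ← map_mul, hu, map_one]
  refine ⟨p ^ (j - v) * zpToW p u, ?_⟩
  rw [hv]
  push_cast
  have : (p : W p) ^ j = p ^ (j - v) * p ^ v := by rw [← pow_add, Nat.sub_add_cancel hle]
  rw [this]
  linear_combination (p : W p) ^ (j - v) * p ^ v * hu'

lemma prod_range_zero_sub {R : Type*} [CommRing R] (j : ℕ) :
    ∏ i ∈ Finset.range j, (0 - ((i : R) + 1)) = (-1) ^ j * (j.factorial : R) := by
  induction j with
  | zero => simp
  | succ j ih =>
    rw [Finset.prod_range_succ, ih, Nat.factorial_succ]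
    push_cast
    ring

/-- For `c ∈ 1 + pW`, the function `(c ^ m - 1) / (p m)` of `m` is `p`-adically continuous, with
value `p⁻¹ log c` at `m = 0`. -/
theorem exists_pow_eq_one_add {c : W p} (hc : (p : W p) ∣ c - 1) : ∃ h : ℕ → W p, PLip p 0 h ∧
    (∀ m : ℕ, c ^ m = 1 + (p * m : ℕ) * h m) ∧
    (p : K p)⁻¹ * logOne p (algebraMap (W p) (K p) c) = algebraMap (W p) (K p) (h 0) := by
  obtain ⟨w, hw⟩ := hc
  obtain rfl : c = p * w + 1 := by linear_combination hw
  choose e he using exists_mul_factorial_eq p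
  -- With `e j = p ^ j / (j + 1)!`, these are partial sums of the binomial expansion of `((1 + p w)
  -- ^ m - 1) / (p m)`, viewed as polynomials in `m`. At `m = 0` they become those of `p⁻¹ log (1 +
  -- p w)`.
  set Q : ℕ → Polynomial (W p) := fun J => ∑ j ∈ Finset.range J, Polynomial.C (e j * w ^ (j + 1)) *
    ∏ i ∈ Finset.range j, (Polynomial.X - Polynomial.C ((i : W p) + 1)) with hQ
  have hQeval (J : ℕ) (x : W p) : (Q J).eval x = ∑ j ∈ Finset.range J, e j * w ^ (j + 1) *
      ∏ i ∈ Finset.range j, (x - ((i : W p) + 1)) := by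
    simp [hQ, Polynomial.eval_finsetSum, Polynomial.eval_prod]
  have hpoly (J i j l : ℕ) (h : i ≡ j [MOD p ^ l]) :
      (p : W p) ^ l ∣ (Q J).eval (i : W p) - (Q J).eval (j : W p) := by
    refine dvd_trans ?_ (Polynomial.sub_dvd_eval_sub _ _ (Q J))
    obtain ⟨x, hx⟩ := (Nat.modEq_iff_dvd.1 h.symm)
    have : (i : W p) - j = p ^ l * x := by exact_mod_cast congrArg (Int.cast : ℤ → W p) hx
    exact ⟨x, this⟩
  have hpow (J m : ℕ) (hm : m ≤ J) : (p * w + 1) ^ m = 1 + (p * m : ℕ) * (Q J).eval (m : W p) := by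
    have h1 : (p * w + 1) ^ m = ∑ j ∈ Finset.range (J + 1), (p * w) ^ j * (m.choose j : W p) := by
      rw [add_pow]
      simp only [one_pow, mul_one]
      refine Finset.sum_subset (Finset.range_subset_range.2 (by omega)) fun j _ hj => ?_
      rw [Nat.choose_eq_zero_of_lt (by simpa using hj)]
      simp
    rw [h1, Finset.sum_range_succ', hQeval, Finset.mul_sum, add_comm]
    simp only [pow_zero, Nat.choose_zero_right, Nat.cast_one, mul_one]
    congr 1
    refine Finset.sum_congr rfl fun j _ => ?_
    have h2 : (((j + 1).factorial * m.choose (j + 1) : ℕ) : W p) =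
        m * ∏ i ∈ Finset.range j, ((m : W p) - ((i : W p) + 1)) := by
      rw [← Nat.descFactorial_eq_factorial_mul_choose, ← descPochhammer_eval_eq_descFactorial,
        descPochhammer_eval_eq_prod_range, Finset.prod_range_succ']
      simp [mul_comm]
    push_cast at h2 ⊢
    have h3 := he j
    calc (p * w) ^ (j + 1) * (m.choose (j + 1) : W p)
        = p ^ j * (p * w ^ (j + 1) * m.choose (j + 1)) := by ring
      _ = p * (e j * w ^ (j + 1)) * ((j + 1).factorial * m.choose (j + 1)) := by rw [← h3]; ring
      _ = _ := by rw [h2]; ring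
  have hstep (J N : ℕ) (h : p * N ≤ J) : (p : W p) ^ N ∣ (Q J).eval 0 - (Q (J + 1)).eval 0 := by
    rw [hQeval, hQeval, Finset.sum_range_succ, sub_add_cancel_left, dvd_neg]
    refine Dvd.dvd.mul_left ?_ _
    rw [prod_range_zero_sub]
    refine Dvd.dvd.mul_left ?_ _
    -- Convergence at `0`: the new term contains `J!`, and `(p N)!` is already divisible by `p ^ N`.
    have h2 : p ^ N ∣ J.factorial := by
      refine dvd_trans ?_ (Nat.factorial_dvd_factorial h)
      clear h
      induction N with
      | zero => simp
      | succ N ih =>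
        rw [mul_add, mul_one, pow_succ]
        exact (mul_dvd_mul ih (Nat.dvd_factorial (Fact.out : p.Prime).pos le_rfl)).trans
          (Nat.factorial_mul_factorial_dvd_factorial_add _ _)
    exact_mod_cast (Nat.cast_dvd_cast (α := W p) h2)
  have hstep' (J J' N : ℕ) (h : p * N ≤ J) (hJ : J ≤ J') :
      (p : W p) ^ N ∣ (Q J).eval 0 - (Q J').eval 0 := by
    induction J', hJ using Nat.le_induction with
    | base => simp
    | succ J' hJ ih =>
      have := dvd_add ih (hstep J' N (h.trans hJ))
      simpa using this
  obtain ⟨L, hL⟩ := exists_limit_of_isAdicComplete (p : W p) (fun n => (Q (p * n)).eval 0)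
    fun n => hstep' _ _ n le_rfl (Nat.mul_le_mul_left p (Nat.le_succ n))
  have hL' (n J : ℕ) (hJ : p * n ≤ J) : (p : W p) ^ n ∣ (Q J).eval 0 - L := by
    have := dvd_sub (hL n) (hstep' _ _ n le_rfl hJ)
    convert this using 1
    ring
  -- For `m ≠ 0` the binomial expansion terminates, so the values stabilize from `J = m` on; at `m =
  -- 0` there is only a limit.
  have hall (m n : ℕ) : ∃ J₀, ∀ J ≥ J₀, (p : W p) ^ n ∣ (Q J).eval (m : W p) -
      (if m = 0 then L else (Q m).eval (m : W p)) := by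
    split_ifs with hm
    · subst hm
      exact ⟨p * n, fun J hJ => by simpa using hL' n J hJ⟩
    · refine ⟨m, fun J hJ => ?_⟩
      have h1 := (hpow J m hJ).symm.trans (hpow m m le_rfl)
      have h2 := mul_left_cancel₀
        (natCast_ne_zero_W (mul_ne_zero (Fact.out : p.Prime).ne_zero hm)) (add_left_cancel h1)
      simp [h2]
  refine ⟨fun m => if m = 0 then L else (Q m).eval (m : W p), fun l i j h => ?_, fun m => ?_, ?_⟩
  · obtain ⟨J1, h1⟩ := hall i l
    obtain ⟨J2, h2⟩ := hall j l
    have := dvd_sub (dvd_add (h2 (max J1 J2) (le_max_right _ _)) (hpoly (max J1 J2) i j l h))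
      (h1 (max J1 J2) (le_max_left _ _))
    rw [add_zero]
    convert this using 1
    ring
  · by_cases hm : m = 0
    · simp [hm]
    · simpa only [if_neg hm] using hpow m m le_rfl
  · have hp0 : (p : K p) ≠ 0 := natCast_ne_zero_K (Fact.out : p.Prime).ne_zero
    have hlog : logOne p (algebraMap (W p) (K p) (p * w + 1)) = p * algebraMap (W p) (K p) L := by
      refine padicLim_eq fun N => eventually_atTop.2 ⟨p * N, fun J hJ => ?_⟩
      obtain ⟨x, hx⟩ := hL' N J hJ
      refine ⟨p * x, ?_⟩
      have h1 : -∑ n ∈ Finset.Icc 1 J, (1 - algebraMap (W p) (K p) (p * w + 1)) ^ n / (n : K p) =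
          p * algebraMap (W p) (K p) ((Q J).eval 0) := by
        rw [hQeval, map_sum, Finset.mul_sum, ← Finset.sum_neg_distrib,
          Finset.range_eq_Ico, ← Finset.Ico_succ_right_eq_Icc,
          Finset.sum_Ico_eq_sum_range, Finset.sum_Ico_eq_sum_range]
        refine Finset.sum_congr (by simp) fun j _ => ?_
        have h3 : ((1 + j : ℕ) : K p) ≠ 0 := natCast_ne_zero_K (by omega)
        rw [← mul_right_inj' h3, zero_add, ← neg_div, mul_div_cancel₀ _ h3]
        have h4 : -(1 - (p * w + 1)) ^ (1 + j) = ((1 + j : ℕ) : W p) * (p * (e j * w ^ (j + 1) *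
            ((-1) ^ j * (j.factorial : W p)))) := by
          have h5 := he j
          rw [Nat.factorial_succ] at h5
          push_cast at h5 ⊢
          have h6 : (1 - (p * w + 1)) ^ (1 + j) = (-1) ^ (j + 1) * p * p ^ j * w ^ (j + 1) := by
            rw [show (1 - (p * w + 1)) = (-1) * p * w by ring, add_comm]
            ring
          rw [h6, ← h5]
          ring
        have h7 := congrArg (algebraMap (W p) (K p)) h4
        rw [prod_range_zero_sub]
        simpa using h7
      rw [h1, ← mul_sub, ← map_sub, hx]
      simp only [map_mul, map_pow, map_natCast]
      ring
    rw [hlog, ← mul_assoc, inv_mul_cancel₀ hp0, one_mul]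
    simp

end Limits

/-! ## The coefficients of `G_a` -/

section Coefficients

variable {p : ℕ} [Fact p.Prime]

/-- The Witt components of `x` lie in `𝔽_p`. Hence `σ` acts on `F_{a'}` only through `t ↦ c t ^ p`.
-/
lemma frobenius_zpToW (x : ℤ_[p]) : WittVector.frobenius (zpToW p x) = zpToW p x := by
  simp only [zpToW, RingHom.comp_apply]
  rw [WittVector.frobenius_eq_map_frobenius]
  ext n
  simp only [WittVector.map_coeff, frobenius_def]
  rw [← map_pow, ZMod.pow_card]

lemma pow_dvd_sub_mem_nhds (z : ℤ_[p]) (M : ℕ) : {x : ℤ_[p] | (p : ℤ_[p]) ^ M ∣ x - z} ∈ 𝓝 z := by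
  have hp : (0 : ℝ) < (p : ℝ) ^ (-(M : ℤ)) :=
    zpow_pos (by exact_mod_cast (Fact.out : p.Prime).pos) _
  refine Filter.mem_of_superset (Metric.closedBall_mem_nhds z hp) fun x hx => ?_
  rw [Metric.mem_closedBall, dist_eq_norm, PadicInt.norm_le_pow_iff_mem_span_pow,
    Ideal.mem_span_singleton] at hx
  exact hx

instance neBot_comap_natCast (z : ℤ_[p]) :
    (comap (fun n : ℕ => (n : ℤ_[p])) (𝓝 z) ⊓ 𝓟 {n : ℕ | 0 < n}).NeBot := by
  rw [Filter.inf_principal_neBot_iff]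
  rintro U ⟨t, ht, hU⟩
  obtain ⟨ε, hε, hb⟩ := Metric.mem_nhds_iff.1 ht
  obtain ⟨M, hM⟩ := PadicInt.exists_pow_neg_lt p hε
  obtain ⟨N, hN⟩ := exists_nat_congr z M
  -- Adding `p ^ M` makes the approximation positive without leaving the ball.
  refine ⟨N + p ^ M, hU (hb ?_), Nat.add_pos_right _ (pow_pos (Fact.out : p.Prime).pos M)⟩
  rw [Metric.mem_ball, dist_eq_norm]
  refine lt_of_le_of_lt ?_ hM
  rw [PadicInt.norm_le_pow_iff_mem_span_pow, Ideal.mem_span_singleton]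
  have := dvd_add hN (dvd_refl ((p : ℤ_[p]) ^ M))
  convert this using 1
  push_cast
  ring

lemma algebraMap_zpToW_inverse {k : ℕ} (hk : ¬ p ∣ k) :
    algebraMap (W p) (K p) (zpToW p (Ring.inverse (k : ℤ_[p]))) = (k : K p)⁻¹ := by
  have h := Ring.mul_inverse_cancel _ (isUnit_natCast_of_not_dvd (p := p) hk)
  have h2 := congrArg (fun x => algebraMap (W p) (K p) (zpToW p x)) h
  simp only [map_mul, map_natCast, map_one] at h2
  exact eq_inv_of_mul_eq_one_right h2

lemma psiTilde_eq {z L : ℤ_[p]} (h : ∀ n, ∃ M, ∀ N : ℕ, (p : ℤ_[p]) ^ M ∣ (N : ℤ_[p]) - z →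
      (p : ℤ_[p]) ^ n ∣ harmonicUnit p N - L) :
    psiTilde p z = algebraMap (W p) (K p) (zpToW p L) := by
  refine padicLim_eq fun n => ?_
  obtain ⟨M, hM⟩ := h n
  refine Filter.Eventually.filter_mono inf_le_left ?_
  filter_upwards [Filter.preimage_mem_comap (pow_dvd_sub_mem_nhds z M)] with N hN
  obtain ⟨x, hx⟩ := hM N hN
  refine ⟨zpToW p x, ?_⟩
  have h1 : ∑ k ∈ (Finset.Ico 1 N).filter (fun k => ¬ p ∣ k), (k : K p)⁻¹ =
      algebraMap (W p) (K p) (zpToW p (harmonicUnit p N)) := by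
    rw [harmonicUnit, map_sum, map_sum]
    exact Finset.sum_congr rfl fun k hk =>
      (algebraMap_zpToW_inverse (Finset.mem_filter.1 hk).2).symm
  rw [h1, ← map_sub, ← map_sub, hx]
  simp

/-- The product of finitely many ratios `{a_i}_k / {1}_k` near `k = 0`. -/
lemma exists_prod_unitRatio_eq {ι : Type*} (s : Finset ι) (a : ι → ℤ_[p]) :
    ∃ P : ℕ → ℤ_[p], PLip p 0 P ∧
      (∀ m, ∏ i ∈ s, unitRatio p (a i) (p * m) = 1 + (p * m : ℕ) * P m) ∧
      algebraMap (W p) (K p) (zpToW p (P 0)) = ∑ i ∈ s, psiTilde p (a i) := by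
  classical
  induction s using Finset.induction_on with
  | empty => exact ⟨fun _ => 0, PLip.const _ _ _, by simp⟩
  | insert b s hb ih =>
    obtain ⟨P, h1, h2, h3⟩ := ih
    obtain ⟨V, g1, g2, g3⟩ := exists_unitRatio_eq_one_add (a b)
    refine ⟨fun m => (P m + V m) + (p : ℤ_[p]) * (m * (P m * V m)), ?_, fun m => ?_, ?_⟩
    · exact (h1.add g1.weaken).add ((PLip.const p 0 _).mul (PLip.natCast.mul (h1.mul g1.weaken)))
    · rw [Finset.prod_insert hb, h2, g2]
      push_cast
      ring
    · rw [Finset.sum_insert hb, ← h3, psiTilde_eq g3]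
      simp [add_comm]

lemma isUnit_prod_unitRatio {ι : Type*} (s : Finset ι) (a : ι → ℤ_[p]) (n : ℕ) :
    IsUnit (∏ i ∈ s, unitRatio p (a i) n) :=
  IsUnit.prod_iff.2 fun _ _ => isUnit_unitRatio _ _

variable {s : ℕ} (a : Fin s → ℤ_[p])

lemma dworkIter_succ (k : ℕ) (i : Fin s) :
    dworkIter p a (k + 1) i = dworkPrime p (dworkIter p a k i) :=
  Function.iterate_succ_apply' _ _ _

/-- `∏_i u_{a_i}(r + p j) · (p (a_i' + j) or 1)`. -/
def dworkRatio (p : ℕ) [Fact p.Prime] {s : ℕ} (a : Fin s → ℤ_[p]) (r j : ℕ) : ℤ_[p] :=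
  ∏ i, (unitRatio p (a i) (r + p * j) * pFactor p (a i) r j)

lemma dworkRatio_pLip (r : ℕ) : PLip p 1 (dworkRatio p a r) :=
  PLip.prod fun i _ => ((unitRatio_pLip (a i)).comp_add_mul r).mul (pFactor_pLip (a i) r)

lemma prod_multichoose_add_mul (k j r : ℕ) (hr : r < p) :
    ∏ i, Ring.multichoose (dworkIter p a k i) (r + p * j) =
      (∏ i, Ring.multichoose (dworkIter p a (k + 1) i) j) * dworkRatio p (dworkIter p a k) r j := by
  rw [dworkRatio, ← Finset.prod_mul_distrib]
  exact Finset.prod_congr rfl fun i _ => by rw [multichoose_add_mul _ _ _ hr, dworkIter_succ]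

lemma prod_multichoose_mul (n : ℕ) :
    ∏ i, Ring.multichoose (a i) (p * n) =
      (∏ i, Ring.multichoose (dworkIter p a 1 i) n) * ∏ i, unitRatio p (a i) (p * n) := by
  have := prod_multichoose_add_mul a 0 n 0 (Fact.out : p.Prime).pos
  simpa [dworkRatio, pFactor, dworkIter] using this

/-- The coefficients of `G_a` are `A_n β(n)`, where `p β(n)` is determined modulo `p ^ l` by `n`
modulo `p ^ l`. -/
theorem exists_coeff_G_eq {c : W p} (hc : (p : W p) ∣ c - 1) : ∃ β : ℕ → W p,
    PLip p 0 (fun n => p * β n) ∧ ∀ n, PowerSeries.coeff n (G p c a) =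
      algebraMap (W p) (K p) (PowerSeries.coeff n (F p a) * β n) := by
  classical
  obtain ⟨h, h1, h2, h3⟩ := exists_pow_eq_one_add hc
  obtain ⟨P, g1, g2, g3⟩ := exists_prod_unitRatio_eq Finset.univ a
  have hv (n : ℕ) := (isUnit_prod_unitRatio Finset.univ a n).exists_right_inv
  choose v hv using hv
  have hvL : PLip p 0 v :=
    PLip.of_mul_eq_one (PLip.prod fun i _ => unitRatio_pLip (a i)) hv
  have hp0 : p ≠ 0 := (Fact.out : p.Prime).ne_zero
  -- This is `(u(pm) - c ^ m) / (pm u(pm))` with the factor `pm` already cancelled, so it makes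
  -- sense at `m = 0` too.
  set γ : ℕ → W p := fun m => zpToW p (v (p * m)) * (zpToW p (P m) - h m) with hγ
  have hγL : PLip p 0 γ := by
    refine (PLip.map (fun l i j hij => ?_) (zpToW p)).mul ((g1.map (zpToW p)).sub h1)
    exact hvL l _ _ (hij.mul_left p)
  set β : ℕ → W p := fun n => if p ∣ n then γ (n / p) else
    zpToW p (Ring.inverse (n : ℤ_[p])) with hβ
  refine ⟨β, ?_, fun n => ?_⟩
  · intro l i j hij
    rw [add_zero]
    rcases l with - | l
    · simp
    rw [pow_succ', ← mul_sub]
    refine mul_dvd_mul_left _ ?_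
    have hd : p ∣ i ↔ p ∣ j := hij.dvd_iff (dvd_pow_self p (Nat.succ_ne_zero l))
    by_cases hi : p ∣ i
    · have hj := hd.1 hi
      simp only [hβ, if_pos hi, if_pos hj]
      obtain ⟨i, rfl⟩ := hi
      obtain ⟨j, rfl⟩ := hj
      rw [Nat.mul_div_cancel_left _ (Nat.pos_of_ne_zero hp0),
        Nat.mul_div_cancel_left _ (Nat.pos_of_ne_zero hp0)]
      -- Passing from `n = pm` to `m` loses one power of `p`, which is why only `p β`, and not `β`,
      -- is claimed to be continuous at level `0`.
      refine hγL l i j (Nat.ModEq.mul_left_cancel' hp0 ?_)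
      rwa [← pow_succ']
    · have hj := mt hd.2 hi
      simp only [hβ, if_neg hi, if_neg hj]
      rw [← map_sub]
      have hi' := Ring.inverse_mul_cancel _ (isUnit_natCast_of_not_dvd (p := p) hi)
      have hj' := Ring.mul_inverse_cancel _ (isUnit_natCast_of_not_dvd (p := p) hj)
      have e1 : Ring.inverse (i : ℤ_[p]) - Ring.inverse (j : ℤ_[p]) =
          -(Ring.inverse (i : ℤ_[p]) * Ring.inverse (j : ℤ_[p])) * ((i : ℤ_[p]) - j) := by
        linear_combination Ring.inverse (j : ℤ_[p]) * hi' - Ring.inverse (i : ℤ_[p]) * hj'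
      have e2 : (p : ℤ_[p]) ^ l ∣ (i : ℤ_[p]) - j :=
        PLip.natCast l i j (hij.of_dvd (pow_dvd_pow p (Nat.le_succ l)))
      have e3 := map_dvd (zpToW p) (e2.mul_left
        (-(Ring.inverse (i : ℤ_[p]) * Ring.inverse (j : ℤ_[p]))))
      rw [← e1] at e3
      simpa using e3
  · rcases eq_or_ne n 0 with rfl | hn
    · have hv0 := hv 0
      simp only [unitRatio_zero, Finset.prod_const_one, one_mul] at hv0
      have hF0 : PowerSeries.coeff 0 (F p a) = 1 := by simp [F]
      -- Each `ψ_p(a_i)` contributes `-γ_p`, cancelling `s γ_p`; what remains is `∑ ψ̃_p(a_i) - p⁻¹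
      -- log c = P(0) - h(0)`.
      simp only [G, map_add, coeff_zero_C, intDlog, coeff_mk, if_true, add_zero, hF0, one_mul,
        hβ, dvd_zero, Nat.zero_div, hγ, mul_zero, hv0, map_one, map_sub, g3, ← h3, digamma,
        Finset.sum_add_distrib, Finset.sum_const, Finset.card_univ, Fintype.card_fin, nsmul_eq_mul]
      ring
    · have hnK : (n : K p) ≠ 0 := natCast_ne_zero_K hn
      have hdiv (x y b : W p) (h : x - y = b * (n : W p)) : (algebraMap (W p) (K p) x -
          algebraMap (W p) (K p) y) / (n : K p) = algebraMap (W p) (K p) b := by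
        rw [div_eq_iff hnK, ← map_sub, h, map_mul, map_natCast]
      simp only [G, map_add, coeff_C, if_neg hn, zero_add, intDlog, coeff_mk, coeff_map, map_sub,
        sub_self]
      refine hdiv _ _ _ ?_
      by_cases hd : p ∣ n
      · obtain ⟨m, rfl⟩ := hd
        simp only [F, sigma, coeff_mk, hβ, dvd_mul_right, if_true,
          Nat.mul_div_cancel_left _ (Nat.pos_of_ne_zero hp0), frobenius_zpToW,
          prod_multichoose_mul, hγ]
        have e1 := congrArg (zpToW p) (g2 m)
        have e2 := congrArg (zpToW p) (hv (p * m))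
        simp only [map_mul, map_add, map_one, map_natCast] at e1 e2 ⊢
        rw [h2 m]
        have e3 : zpToW p (∏ i, unitRatio p (a i) (p * m)) - (1 + (p * m : ℕ) * h m) =
            (p * m : ℕ) * (zpToW p (P m) - h m) := by rw [e1]; ring
        linear_combination zpToW p (∏ i, Ring.multichoose (dworkIter p a 1 i) m) * e3 -
          zpToW p (∏ i, Ring.multichoose (dworkIter p a 1 i) m) *
          (zpToW p (P m) - h m) * (p * m : ℕ) * e2
      · simp only [F, sigma, coeff_mk, hβ, if_neg hd, sub_zero]
        have e1 := congrArg (zpToW p)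
          (Ring.inverse_mul_cancel _ (isUnit_natCast_of_not_dvd (p := p) hd))
        simp only [map_mul, map_one, map_natCast] at e1
        rw [mul_assoc, e1, mul_one]

end Coefficients

/-! ## Truncations of `F_a` modulo `p` -/

section Truncations

lemma coe_polynomial_expand {R : Type*} [CommRing R] {p : ℕ} (hp : p ≠ 0) (f : Polynomial R) :
    ((Polynomial.expand R p f : Polynomial R) : R⟦X⟧) = PowerSeries.expand p hp (f : R⟦X⟧) := by
  ext n
  rw [Polynomial.coeff_coe, Polynomial.coeff_expand (Nat.pos_of_ne_zero hp)]
  split_ifs with h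
  · obtain ⟨m, rfl⟩ := h
    rw [coeff_expand_mul, Polynomial.coeff_coe, Nat.mul_div_cancel_left _ (Nat.pos_of_ne_zero hp)]
  · rw [coeff_expand_of_not_dvd p hp _ h]

lemma tr_eq_sum {R : Type*} [CommRing R] (M : ℕ) (h : R⟦X⟧) :
    tr M h = ∑ r ∈ Finset.range M, X ^ r * C (coeff r h) := by
  ext n
  simp [coeff_tr, coeff_mul_C, coeff_X_pow]

/-- If `h_{r + p j} = h_r g_j` for `r < p`, then `h_{<pM} = h_{<p} · g_{<M}(t ^ p)`. -/
lemma trunc_mul_of_coeff_add_mul {R : Type*} [CommRing R] {p : ℕ} (hp : p ≠ 0) {h g : R⟦X⟧}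
    (hh : ∀ r < p, ∀ j, coeff (r + p * j) h = coeff r h * coeff j g) (M : ℕ) :
    trunc (p * M) h = trunc p h * Polynomial.expand R p (trunc M g) := by
  refine Polynomial.coe_injective R ?_
  rw [Polynomial.coe_mul, coe_polynomial_expand hp]
  change tr (p * M) h = tr p h * expand p hp (tr M g)
  rw [eq_sum_residuePart p hp (tr (p * M) h), tr_eq_sum p h, Finset.sum_mul]
  refine Finset.sum_congr rfl fun r hr => ?_
  have h1 : residuePart p r h = C (coeff r h) * g := by
    ext j
    rw [residuePart, coeff_mk, coeff_C_mul, hh r (Finset.mem_range.1 hr)]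
  rw [residuePart_tr (Finset.mem_range.1 hr), h1, tr_C_mul, map_mul, expand_C, mul_assoc]

variable {p : ℕ} [Fact p.Prime] {s : ℕ} (a : Fin s → ℤ_[p])

/-- `F_a(t)` as a power series over `ℤ_p`. -/
def zpF (p : ℕ) [Fact p.Prime] {s : ℕ} (a : Fin s → ℤ_[p]) : PowerSeries ℤ_[p] :=
  PowerSeries.mk fun n => ∏ i, Ring.multichoose (a i) n

lemma dworkIter_zero : dworkIter p a 0 = a := rfl

lemma map_zpF : PowerSeries.map (zpToW p) (zpF p a) = F p a := by
  ext n
  simp [zpF, F]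

lemma coeff_zero_zpF : coeff 0 (zpF p a) = 1 := by simp [zpF]

lemma coeff_zero_F : coeff 0 (F p a) = 1 := by simp [F]

/-- Modulo `p` the factor `dworkRatio` is independent of `j`, and its value at `j = 0` is the
coefficient of index `r`. -/
lemma coeff_toZMod_zpF (k r : ℕ) (hr : r < p) (j : ℕ) :
    coeff (r + p * j) ((zpF p (dworkIter p a k)).map PadicInt.toZMod) =
      coeff r ((zpF p (dworkIter p a k)).map PadicInt.toZMod) *
        coeff j ((zpF p (dworkIter p a (k + 1))).map PadicInt.toZMod) := by
  have h0 := prod_multichoose_add_mul a k 0 r hr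
  simp only [mul_zero, add_zero, Ring.multichoose_zero_right, Finset.prod_const_one,
    one_mul] at h0
  have h1 := dworkRatio_pLip (dworkIter p a k) r 0 j 0 (by simpa using Nat.modEq_one)
  have h2 : PadicInt.toZMod (dworkRatio p (dworkIter p a k) r j) =
      PadicInt.toZMod (dworkRatio p (dworkIter p a k) r 0) := by
    have := map_dvd (PadicInt.toZMod (p := p)) h1
    simpa [sub_eq_zero] using this
  simp only [coeff_map, zpF, coeff_mk]
  rw [prod_multichoose_add_mul a k j r hr, h0, map_mul, h2, mul_comm]

lemma trunc_toZMod_zpF (k N : ℕ) :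
    trunc (p ^ N) ((zpF p (dworkIter p a k)).map PadicInt.toZMod) =
      ∏ i ∈ Finset.range N,
        trunc p ((zpF p (dworkIter p a (k + i))).map PadicInt.toZMod) ^ p ^ i := by
  induction N generalizing k with
  | zero =>
    rw [pow_zero, trunc_one_left, coeff_map, coeff_zero_zpF]
    simp
  | succ N ih =>
    -- Over `𝔽_p`, `g(t ^ p) = g(t) ^ p`; this converts the factor in `t ^ p` into a `p`-th power.
    rw [pow_succ',
      trunc_mul_of_coeff_add_mul (Fact.out : p.Prime).ne_zero (coeff_toZMod_zpF a k), ih,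
      ZMod.expand_card, Finset.prod_range_succ', ← Finset.prod_pow, mul_comm]
    simp only [pow_zero, pow_one, add_zero]
    congr 1
    exact Finset.prod_congr rfl fun i _ => by rw [← pow_mul, ← pow_succ, add_right_comm, add_assoc]

/-- `F_a(t)_{<p ^ N} ≡ ∏_{i < N} (F_{a^(i)}(t)_{<p}) ^ (p ^ i) mod p`. -/
theorem dvd_trunc_F_sub_prod (N : ℕ) : (p : Polynomial (W p)) ∣
    trunc (p ^ N) (F p a) - ∏ i ∈ Finset.range N, trunc p (F p (dworkIter p a i)) ^ p ^ i := by
  have h1 : (p : Polynomial ℤ_[p]) ∣ trunc (p ^ N) (zpF p a) -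
      ∏ i ∈ Finset.range N, trunc p (zpF p (dworkIter p a i)) ^ p ^ i := by
    rw [← Polynomial.C_eq_natCast, Polynomial.C_dvd_iff_dvd_coeff]
    intro n
    rw [← Ideal.mem_span_singleton, ← PadicInt.maximalIdeal_eq_span_p, ← PadicInt.ker_toZMod,
      RingHom.mem_ker, ← Polynomial.coeff_map]
    have := trunc_toZMod_zpF a 0 N
    simp only [zero_add, trunc_map] at this
    rw [Polynomial.map_sub, Polynomial.map_prod]
    simp only [Polynomial.map_pow]
    rw [← this, dworkIter_zero]
    simp
  have h2 := map_dvd (Polynomial.mapRingHom (zpToW p)) h1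
  simpa [Polynomial.map_prod, ← trunc_map, map_zpF] using h2

lemma dworkIter_mod {r : ℕ} (hr : ∀ i, dworkIter p a (r + 1) i = a i) (k : ℕ) :
    dworkIter p a (k % (r + 1)) = dworkIter p a k :=
  funext fun i => Function.IsPeriodicPt.iterate_mod_apply (hr i) k

lemma isUnit_prod_trunc {S : Type*} [CommRing S] {r : ℕ}
    (hr : ∀ i, dworkIter p a (r + 1) i = a i) (φ : Polynomial (W p) →+* S)
    (hφ : ∀ f ∈ truncSet p a r, IsUnit (φ f)) (N : ℕ) :
    IsUnit (φ (∏ i ∈ Finset.range N, trunc p (F p (dworkIter p a i)) ^ p ^ i)) := by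
  rw [map_prod]
  refine IsUnit.prod_iff.2 fun i _ => ?_
  rw [map_pow]
  refine IsUnit.pow _ (hφ _ ⟨i % (r + 1), Nat.lt_succ_iff.1 (Nat.mod_lt _ r.succ_pos), ?_⟩)
  rw [dworkIter_mod a hr]

/-- An element congruent to a unit modulo `q` is inverted modulo `q ^ n` by a truncated geometric
series. -/
lemma exists_mul_congr_one {S : Type*} [CommRing S] {q y z : S} (hy : IsUnit y) (h : q ∣ z - y)
    (n : ℕ) : ∃ x, q ^ n ∣ z * x - 1 := by
  obtain ⟨u, hu⟩ := hy.exists_right_inv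
  obtain ⟨d, hd⟩ := h
  refine ⟨u * ∑ i ∈ Finset.range n, (-(q * d * u)) ^ i, ?_⟩
  have h1 := mul_neg_geom_sum (-(q * d * u)) n
  have h2 : z * u = 1 - -(q * d * u) := by linear_combination hu + u * hd
  rw [← mul_assoc, h2, h1]
  refine ⟨-(-(d * u)) ^ n, ?_⟩
  rw [show -(q * d * u) = q * -(d * u) by ring, mul_pow]
  ring

/-- `G · F_{<p ^ (N + 1)} ≡ F · G_{<p ^ (N + 1)} mod p ^ N`. -/
theorem pow_dvd_mul_tr_sub {β : ℕ → W p} (hβ : PLip p 0 (fun n => p * β n)) (N : ℕ) :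
    (p : (W p)⟦X⟧) ^ N ∣ wser (fun n => coeff n (F p a)) β * tr (p ^ (N + 1)) (F p a) -
      F p a * tr (p ^ (N + 1)) (wser (fun n => coeff n (F p a)) β) := by
  have hp : (p : W p) ≠ 0 := p_ne_zero_W
  -- The weights are `1` and `p β`. The level is `N + 1` because the factor `p` of the second weight
  -- is divided out at the end.
  have h := pow_dvd_bracket (R := W p) p (Fact.out : p.Prime).ne_zero
    (IsLeftCancelMulZero.mul_left_cancel_of_ne_zero hp)
    (fun k n => coeff n (F p (dworkIter p a k)))
    (fun k r j => zpToW p (dworkRatio p (dworkIter p a k) r j))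
    (fun k r hr j => by
      simp only [F, coeff_mk]
      rw [prod_multichoose_add_mul a k j r hr, map_mul])
    (fun k r _ => (dworkRatio_pLip (dworkIter p a k) r).map (zpToW p)) (N + 1) 0
    (fun _ => 1) _ (PLip.const p 0 1) hβ
  have h1 : wser (fun n => coeff n (F p (dworkIter p a 0))) (fun _ => 1) = F p a := by
    ext n
    simp [wser, dworkIter_zero]
  have h2 : wser (fun n => coeff n (F p (dworkIter p a 0))) (fun n => p * β n) =
      C (p : W p) * wser (fun n => coeff n (F p a)) β := by
    ext n
    simp only [wser, coeff_mk, coeff_C_mul, dworkIter_zero]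
    rw [mul_left_comm]
  rw [bracket, h1, h2, tr_C_mul, map_natCast] at h
  have h3 : (p : (W p)⟦X⟧) ≠ 0 := by
    intro h0
    have := congrArg constantCoeff h0
    rw [map_natCast, map_zero] at this
    exact hp this
  rw [dvd_sub_comm]
  refine (mul_dvd_mul_iff_left h3).1 ?_
  rw [← pow_succ']
  convert h using 1
  ring

end Truncations

/-! ## Rings of convergent functions -/

section Convergent

variable {p : ℕ}

/-- This reduces computations with the extended map modulo `p ^ n` to a representative in `A`. -/
lemma pow_dvd_extendHom_sub {A S : Type*} [CommRing A] [CommRing S]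
    [IsAdicComplete (Ideal.span {(p : S)}) S] (φ : A →+* S) {n : ℕ}
    {y : AdicCompletion (Ideal.span {(p : A)}) A} {x : A}
    (h : AdicCompletion.evalₐ (Ideal.span {(p : A)}) n y = Ideal.Quotient.mk _ x) :
    (p : S) ^ n ∣ extendHom p φ y - φ x := by
  rw [← Ideal.mem_span_singleton, ← Ideal.span_singleton_pow, ← Ideal.Quotient.eq, extendHom,
    IsAdicComplete.mk_liftRingHom]
  simp only [RingHom.comp_apply, RingHom.coe_coe, h]
  rfl

lemma exists_evalₐ_eq {A : Type*} [CommRing A] (y : AdicCompletion (Ideal.span {(p : A)}) A)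
    (n : ℕ) : ∃ x : A, AdicCompletion.evalₐ (Ideal.span {(p : A)}) n y = Ideal.Quotient.mk _ x := by
  obtain ⟨x, hx⟩ := Ideal.Quotient.mk_surjective (AdicCompletion.evalₐ (Ideal.span {(p : A)}) n y)
  exact ⟨x, hx.symm⟩

lemma exists_adicCompletion {A : Type*} [CommRing A] (x : ℕ → A)
    (hx : ∀ n, (p : A) ^ n ∣ x n - x (n + 1)) : ∃ y : AdicCompletion (Ideal.span {(p : A)}) A,
      ∀ n, AdicCompletion.evalₐ (Ideal.span {(p : A)}) n y = Ideal.Quotient.mk _ (x n) := by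
  refine ⟨AdicCompletion.mk _ _ (AdicCompletion.AdicCauchySequence.mk _ _ x fun n => ?_),
    fun n => ?_⟩
  · rw [SModEq.sub_mem, smul_eq_mul, Ideal.mul_top, Ideal.span_singleton_pow,
      Ideal.mem_span_singleton]
    exact hx n
  · rw [AdicCompletion.evalₐ_mk]
    rfl

lemma natCast_pow_dvd_polynomial {R : Type*} [CommRing R] {n : ℕ} {q : Polynomial R}
    (h : (p : R⟦X⟧) ^ n ∣ (q : R⟦X⟧)) : (p : Polynomial R) ^ n ∣ q := by
  have e : (p : Polynomial R) ^ n = Polynomial.C ((p : R) ^ n) := by simp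
  rw [e, Polynomial.C_dvd_iff_dvd_coeff]
  intro m
  rw [← Ideal.mem_span_singleton, ← Ideal.span_singleton_pow] at h
  have := (mem_span_pow_iff p n _).1 h m
  rwa [Polynomial.coeff_coe, Ideal.span_singleton_pow, Ideal.mem_span_singleton] at this

variable [Fact p.Prime]

/-- The Taylor expansion `W[t, f⁻¹ (f ∈ T)] → W⟦t⟧`. -/
def locExpansion (T : Set (Polynomial (W p)))
    (hT : ∀ f ∈ T, IsUnit (Polynomial.coeToPowerSeries.ringHom f)) : LocRing p T →+* (W p)⟦X⟧ :=
  IsLocalization.lift (M := Submonoid.closure T)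
    (isUnit_map_of_mem_closure Polynomial.coeToPowerSeries.ringHom hT)

lemma locExpansion_algebraMap (T : Set (Polynomial (W p)))
    (hT : ∀ f ∈ T, IsUnit (Polynomial.coeToPowerSeries.ringHom f)) (q : Polynomial (W p)) :
    locExpansion T hT (algebraMap _ (LocRing p T) q) = (q : (W p)⟦X⟧) :=
  IsLocalization.lift_eq _ q

/-- The Taylor expansion is injective modulo `p ^ n`. -/
lemma pow_dvd_of_pow_dvd_locExpansion (T : Set (Polynomial (W p)))
    (hT : ∀ f ∈ T, IsUnit (Polynomial.coeToPowerSeries.ringHom f)) {n : ℕ} {x : LocRing p T}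
    (h : (p : (W p)⟦X⟧) ^ n ∣ locExpansion T hT x) : (p : LocRing p T) ^ n ∣ x := by
  obtain ⟨⟨q, g⟩, hg⟩ := IsLocalization.surj (Submonoid.closure T) x
  -- Multiplying by a denominator leaves a polynomial, for which divisibility by `p ^ n` is read off
  -- its coefficients.
  have h1 : (p : (W p)⟦X⟧) ^ n ∣ (q : (W p)⟦X⟧) := by
    rw [← locExpansion_algebraMap T hT, ← hg, map_mul]
    exact h.mul_right _
  have h2 := map_dvd (algebraMap _ (LocRing p T)) (natCast_pow_dvd_polynomial h1)
  rw [map_pow, map_natCast, ← hg] at h2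
  exact ((IsLocalization.map_units (LocRing p T) g).dvd_mul_right).1 h2

/-- The expansion of elements of `W⟨t, f⁻¹ (f ∈ T)⟩` is injective. -/
lemma expansion_injective (T : Set (Polynomial (W p)))
    (hT : ∀ f ∈ T, IsUnit (Polynomial.coeToPowerSeries.ringHom f)) :
    Function.Injective (expansion p T hT) := by
  rw [injective_iff_map_eq_zero]
  intro f hf
  refine AdicCompletion.ext_evalₐ fun n => ?_
  obtain ⟨x, hx⟩ := exists_evalₐ_eq f n
  have h1 : (p : (W p)⟦X⟧) ^ n ∣ expansion p T hT f - locExpansion T hT x :=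
    pow_dvd_extendHom_sub _ hx
  rw [hf, zero_sub, dvd_neg] at h1
  have h2 := pow_dvd_of_pow_dvd_locExpansion T hT h1
  rw [hx, map_zero, Ideal.Quotient.eq_zero_iff_mem, Ideal.span_singleton_pow,
    Ideal.mem_span_singleton]
  exact h2

end Convergent

/-! ## Convergence of `G_{<p ^ n} / F_{<p ^ n}` -/

section Main

variable {p : ℕ} [Fact p.Prime] {s : ℕ} (a : Fin s → ℤ_[p])

lemma isUnit_of_coeff_zero_eq_one {R : Type*} [CommRing R] {f : R⟦X⟧} (h : coeff 0 f = 1) :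
    IsUnit f := by
  rw [PowerSeries.isUnit_iff_constantCoeff, ← PowerSeries.coeff_zero_eq_constantCoeff_apply, h]
  exact isUnit_one

lemma isUnit_F : IsUnit (F p a) := isUnit_of_coeff_zero_eq_one (coeff_zero_F a)

lemma isUnit_tr_F (N : ℕ) : IsUnit (tr (p ^ N) (F p a)) :=
  isUnit_of_coeff_zero_eq_one (by
    rw [coeff_tr, if_pos (pow_pos (Fact.out : p.Prime).pos N), coeff_zero_F])

/-- If `G` denotes the series with coefficients in `W` of which `G_a` is the image, then
`ℱ_a` is the image of `f` iff `f F_a = G`. -/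
lemma map_eq_logF_iff {c : W p} {g : (W p)⟦X⟧}
    (hg : G p c a = PowerSeries.map (algebraMap (W p) (K p)) g) (f : (W p)⟦X⟧) :
    PowerSeries.map (algebraMap (W p) (K p)) f = logF p c a ↔ f * F p a = g := by
  have h0 : constantCoeff (PowerSeries.map (algebraMap (W p) (K p)) (F p a)) ≠ 0 := by
    rw [← PowerSeries.coeff_zero_eq_constantCoeff_apply, coeff_map, coeff_zero_F, map_one]
    exact one_ne_zero
  rw [logF, PowerSeries.eq_mul_inv_iff_mul_eq h0, hg, ← map_mul]
  exact (PowerSeries.map_injective _ (IsFractionRing.injective (W p) (K p))).eq_iff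

lemma powerSeries_eq_of_forall_pow_dvd {f g : (W p)⟦X⟧}
    (h : ∀ n, (p : (W p)⟦X⟧) ^ n ∣ f - g) : f = g := by
  rw [← sub_eq_zero]
  refine IsHausdorff.haus (I := Ideal.span {(p : (W p)⟦X⟧)}) inferInstance _ fun n => ?_
  rw [SModEq.sub_mem, sub_zero, smul_eq_mul, Ideal.mul_top, Ideal.span_singleton_pow,
    Ideal.mem_span_singleton]
  exact h n

variable {r : ℕ} (hr : ∀ i, dworkIter p a (r + 1) i = a i) {g : (W p)⟦X⟧}
  (hg : ∀ N, (p : (W p)⟦X⟧) ^ N ∣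
    g * tr (p ^ (N + 1)) (F p a) - F p a * tr (p ^ (N + 1)) g)

include hr hg in
/-- The quotients `G_{<p ^ (n + 1)} / F_{<p ^ (n + 1)} mod p ^ n` define an element of
`W⟨t, f⁻¹ (f ∈ T)⟩` with expansion `G / F`. -/
lemma exists_expansion_mul_eq :
    ∃ f, expansion p (truncSet p a r) (isUnit_truncSet p a r) f * F p a = g := by
  set T := truncSet p a r
  set ψ := locExpansion T (isUnit_truncSet p a r)
  have hz (n : ℕ) : ∃ z : LocRing p T,
      (p : LocRing p T) ^ n ∣ algebraMap _ _ (trunc (p ^ (n + 1)) (F p a)) * z - 1 := by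
    refine exists_mul_congr_one (isUnit_prod_trunc a hr (algebraMap _ (LocRing p T))
      (fun f hf => ?_) (n + 1)) ?_ n
    · exact IsLocalization.map_units (LocRing p T)
        (⟨f, Submonoid.subset_closure hf⟩ : Submonoid.closure T)
    · have := map_dvd (algebraMap _ (LocRing p T)) (dvd_trunc_F_sub_prod a (n + 1))
      rwa [map_natCast, map_sub] at this
  choose z hz using hz
  set x : ℕ → LocRing p T := fun n => algebraMap _ _ (trunc (p ^ (n + 1)) g) * z n with hx
  have hψ (n : ℕ) : (p : (W p)⟦X⟧) ^ n ∣ ψ (x n) * F p a - g := by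
    have h1 := map_dvd ψ (hz n)
    rw [map_pow, map_natCast, map_sub, map_mul, map_one, locExpansion_algebraMap] at h1
    have h2 : ψ (x n) = tr (p ^ (n + 1)) g * ψ (z n) := by
      rw [hx, map_mul, locExpansion_algebraMap]
      rfl
    rw [h2, ← (isUnit_tr_F a (n + 1)).dvd_mul_left]
    have := dvd_sub (h1.mul_left (tr (p ^ (n + 1)) g * F p a)) (hg n)
    convert this using 1
    rw [tr, tr]
    ring
  -- The Cauchy condition is checked on expansions, where `F_a` is a unit and both terms times `F_a`
  -- approximate `g`.
  obtain ⟨f, hf⟩ := exists_adicCompletion (p := p) x fun n => by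
    refine pow_dvd_of_pow_dvd_locExpansion T (isUnit_truncSet p a r) ?_
    rw [← (isUnit_F a).dvd_mul_right, map_sub]
    have := dvd_sub (hψ n) ((pow_dvd_pow _ n.le_succ).trans (hψ (n + 1)))
    convert this using 1
    ring
  refine ⟨f, powerSeries_eq_of_forall_pow_dvd fun n => ?_⟩
  have h1 : (p : (W p)⟦X⟧) ^ n ∣ expansion p T (isUnit_truncSet p a r) f - ψ (x n) :=
    pow_dvd_extendHom_sub _ (hf n)
  have := dvd_add (h1.mul_right (F p a)) (hψ n)
  convert this using 1
  ring

include hr in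
lemma isUnit_eval_trunc_F {α : W p} (hα : ∀ k ≤ r, ¬ (p : W p) ∣
    (PowerSeries.trunc p (F p (dworkIter p a k))).eval α) (N : ℕ) :
    IsUnit ((PowerSeries.trunc (p ^ N) (F p a)).eval α) := by
  refine isUnit_of_not_dvd p fun h => ?_
  have h1 := isUnit_prod_trunc a hr (Polynomial.evalRingHom α) (isUnit_eval_truncSet p hα) N
  have h2 := map_dvd (Polynomial.evalRingHom α) (dvd_trunc_F_sub_prod a N)
  rw [map_natCast, map_sub] at h2
  have h3 := isUnit_of_dvd_unit ((dvd_iff_of_dvd_sub h2).1 h) h1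
  have hpN : (p : W p) ∈ nonunits (W p) := by
    rw [mem_nonunits_iff]
    intro hu
    have h4 := hu.map (WittVector.constantCoeff (p := p) (R := AlgebraicClosure (ZMod p)))
    rw [map_natCast, CharP.cast_eq_zero] at h4
    exact not_isUnit_zero h4
  exact hpN h3

include hg in
/-- The value at `α` of the element with expansion `G / F` is congruent to
`G(α)_{<p ^ (N + 1)} / F(α)_{<p ^ (N + 1)}` modulo `p ^ N`. -/
lemma pow_dvd_valueAt {f : ConvRing p (truncSet p a r)}
    (hf : expansion p (truncSet p a r) (isUnit_truncSet p a r) f * F p a = g) {α : W p}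
    (hα : ∀ f ∈ truncSet p a r, IsUnit (Polynomial.evalRingHom α f)) (N : ℕ) :
    (p : W p) ^ N ∣ (trunc (p ^ (N + 1)) g).eval α -
      valueAt p (truncSet p a r) α hα f * (trunc (p ^ (N + 1)) (F p a)).eval α := by
  set ψ := locExpansion (truncSet p a r) (isUnit_truncSet p a r)
  set φ : LocRing p (truncSet p a r) →+* W p :=
    IsLocalization.lift (M := Submonoid.closure (truncSet p a r))
    (isUnit_map_of_mem_closure (Polynomial.evalRingHom α) hα)
  have hφ (q : Polynomial (W p)) : φ (algebraMap _ _ q) = q.eval α := IsLocalization.lift_eq _ q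
  obtain ⟨x, hx⟩ := exists_evalₐ_eq f N
  have h1 : (p : (W p)⟦X⟧) ^ N ∣ expansion p (truncSet p a r) (isUnit_truncSet p a r) f - ψ x :=
    pow_dvd_extendHom_sub _ hx
  have h2 : (p : W p) ^ N ∣ valueAt p (truncSet p a r) α hα f - φ x := pow_dvd_extendHom_sub _ hx
  -- Power series cannot be evaluated at a general `α`, so the congruence is first brought down to
  -- the localization, where evaluation is defined.
  have h3 : (p : LocRing p (truncSet p a r)) ^ N ∣ algebraMap _ _ (trunc (p ^ (N + 1)) g) -
      x * algebraMap _ _ (trunc (p ^ (N + 1)) (F p a)) := by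
    refine pow_dvd_of_pow_dvd_locExpansion (truncSet p a r) (isUnit_truncSet p a r) ?_
    rw [map_sub, map_mul, locExpansion_algebraMap, locExpansion_algebraMap,
      ← (isUnit_F a).dvd_mul_left]
    have := dvd_sub (h1.mul_left (F p a * tr (p ^ (N + 1)) (F p a))) (hg N)
    convert this using 1
    rw [← hf, tr, tr]
    ring
  have h4 := map_dvd φ h3
  rw [map_pow, map_natCast, map_sub, map_mul, hφ, hφ] at h4
  have := dvd_sub h4 (h2.mul_right ((trunc (p ^ (N + 1)) (F p a)).eval α))
  convert this using 1
  ring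

end Main

end PadicHG

end

theorem corollary3p3 (p : ℕ) [Fact p.Prime] (s : ℕ) (hs : 1 ≤ s) (a : Fin s → ℤ_[p])
    (c : PadicHG.W p) (hc : (p : PadicHG.W p) ∣ c - 1) (r : ℕ)
    (hr : ∀ i, PadicHG.dworkIter p a (r + 1) i = a i) :
    (∃! f : PadicHG.ConvRing p (PadicHG.truncSet p a r),
      PowerSeries.map (algebraMap (PadicHG.W p) (PadicHG.K p))
          (PadicHG.expansion p (PadicHG.truncSet p a r) (PadicHG.isUnit_truncSet p a r) f) =
        PadicHG.logF p c a) ∧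
    ∀ f : PadicHG.ConvRing p (PadicHG.truncSet p a r),
      PowerSeries.map (algebraMap (PadicHG.W p) (PadicHG.K p))
          (PadicHG.expansion p (PadicHG.truncSet p a r) (PadicHG.isUnit_truncSet p a r) f) =
        PadicHG.logF p c a →
      ∀ (α : PadicHG.W p)
        (hα : ∀ k ≤ r, ¬ (p : PadicHG.W p) ∣
          (PowerSeries.trunc p (PadicHG.F p (PadicHG.dworkIter p a k))).eval α),
        (∀ n : ℕ, (PowerSeries.trunc (p ^ n) (PadicHG.F p a)).eval α ≠ 0) ∧
        Filter.Tendsto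
          (fun n : ℕ =>
            (PowerSeries.trunc (p ^ n) (PadicHG.G p c a)).eval
                (algebraMap (PadicHG.W p) (PadicHG.K p) α) /
              algebraMap (PadicHG.W p) (PadicHG.K p)
                ((PowerSeries.trunc (p ^ n) (PadicHG.F p a)).eval α))
          Filter.atTop
          (PadicHG.padicNhds p (algebraMap (PadicHG.W p) (PadicHG.K p)
            (PadicHG.valueAt p (PadicHG.truncSet p a r) α
              (PadicHG.isUnit_eval_truncSet p hα) f))) := by
  obtain ⟨β, hβ, hG⟩ := PadicHG.exists_coeff_G_eq a hc
  have hg := PadicHG.pow_dvd_mul_tr_sub a hβ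
  set g := PadicHG.wser (fun n => PowerSeries.coeff n (PadicHG.F p a)) β with hgdef
  have hGg : PadicHG.G p c a =
      PowerSeries.map (algebraMap (PadicHG.W p) (PadicHG.K p)) g := by
    ext n
    rw [hG, PowerSeries.coeff_map, hgdef, PadicHG.wser, PowerSeries.coeff_mk]
  simp only [PadicHG.map_eq_logF_iff a hGg]
  refine ⟨?_, fun f hf α hα => ?_⟩
  · obtain ⟨f, hf⟩ := PadicHG.exists_expansion_mul_eq a hr hg
    refine ⟨f, hf, fun f' hf' => PadicHG.expansion_injective _ (PadicHG.isUnit_truncSet p a r) ?_⟩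
    exact (PadicHG.isUnit_F a).mul_right_cancel (hf'.trans hf.symm)
  · have hu := PadicHG.isUnit_eval_trunc_F a hr hα
    refine ⟨fun n => (hu n).ne_zero, PadicHG.tendsto_padicNhds_iff.2 fun N =>
      Filter.eventually_atTop.2 ⟨N + 1, fun n hn => ?_⟩⟩
    -- Truncation at `p ^ (m + 1)` gives precision `p ^ m`, so precision `p ^ N` starts at index `N
    -- + 1`.
    obtain ⟨n, rfl⟩ : ∃ m, n = m + 1 := ⟨n - 1, by omega⟩
    obtain ⟨u, hu'⟩ := (hu (n + 1)).exists_right_inv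
    obtain ⟨d, hd⟩ := (pow_dvd_pow _ (by omega : N ≤ n)).trans
      (PadicHG.pow_dvd_valueAt a hg hf (PadicHG.isUnit_eval_truncSet p hα) n)
    refine ⟨d * u, ?_⟩
    rw [hGg, PowerSeries.trunc_map, Polynomial.eval_map_algebraMap,
      Polynomial.aeval_algebraMap_apply, Polynomial.coe_aeval_eq_eval]
    have hd' := congrArg (algebraMap (PadicHG.W p) (PadicHG.K p)) hd
    have hu'' := congrArg (algebraMap (PadicHG.W p) (PadicHG.K p)) hu'
    simp only [map_mul, map_sub, map_pow, map_natCast, map_one] at hd' hu'' ⊢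
    rw [div_eq_mul_inv, inv_eq_of_mul_eq_one_right hu'']
    linear_combination algebraMap (PadicHG.W p) (PadicHG.K p) u * hd' +
      algebraMap (PadicHG.W p) (PadicHG.K p) (PadicHG.valueAt p (PadicHG.truncSet p a r) α
        (PadicHG.isUnit_eval_truncSet p hα) f) * hu''
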